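/- Let $\mathbb K$ be a field of characteristic $0$, let $\Lambda$ be a free abelian group, and let $\mathcal L$ be a Lie algebra over $\mathbb K$ (possibly infinite-dimensional). **Root-graded Lie algebras.** Let $\mathfrak g\subseteq\mathcal L$ be a finite-dimensional simple subalgebra with a splitting Cartan subalgebra $\mathfrak h$, let $R\ni 0$ be the root system of $(\mathfrak g,\mathfrak h)$ and $R^\times=R\setminus\{0\}$; assume that $R$ is simply-laced of rank $\dim\mathfrak h\ge 2$. Put $\mathcal L_\alpha=\{x\in\mathcal L : [h,x]=\alpha(h)x \text{ for all } h\in\mathfrak h\}$. Assume that $\mathcal L$ is division $(R,\Lambda)$-graded, that is: * $\mathcal L=\bigoplus_{\alpha\in R}\mathcal L_\alpha$ and $\mathcal L_0=\sum_{\alpha\in R^\times}[\mathcal L_\alpha,\mathcal L_{-\alpha}]$; * $\mathcal L=\bigoplus_{\lambda\in\Lambda}\mathcal L^\lambda$ is a $\Lambda$-graded Lie algebra, $\mathfrak g\subseteq\mathcal L^0$, and $\{\lambda : \mathcal L^\lambda\ne 0\}$ generates $\Lambda$; * writing $\mathcal L_\alpha^\lambda=\mathcal L_\alpha\cap\mathcal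 L^\lambda$, for all $\alpha\in R^\times$, $\lambda\in\Lambda$ and $0\ne x\in\mathcal L_\alpha^\lambda$ there is $y\in\mathcal L_{-\alpha}^{-\lambda}$ with $[[x,y],z]=\langle\beta,\alpha^\vee\rangle z$ for all $\beta\in R$, $z\in\mathcal L_\beta$. Assume that $\mathcal L$ has a Chevalley involution $\tau$: an automorphism of the Lie algebra $\mathcal L$ with $\tau^2=\mathrm{id}$, $\tau(\mathfrak g)=\mathfrak g$, $\tau(\mathcal L^\lambda)=\mathcal L^{-\lambda}$ for all $\lambda\in\Lambda$, and $\tau(x)=-x$ for all $x\in\mathcal L^0_0$. **The coordinate algebra.** Let $e_\alpha\in\mathfrak g_\alpha$ ($\alpha\in R^\times$) be the root vectors of any Chevalley basis of $\mathfrak g$. Let $\mathcal N\subseteq \mathrm{GL}(\mathcal L)$ be the group generated by the maps $\exp(\mathrm{ad}\,te_\alpha)\exp(\mathrm{ad}(-t^{-1}e_{-\alpha}))\exp(\mathrm{ad}\,te_\alpha)$ with $\alpha\in R^\times$, $t\in\mathbb K^\times$. For $\alpha,\beta\in R^\times$ let $\theta_{\beta,\alpha}:\mathcal L_\alpha\to\mathcal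 L_\beta$ be $\epsilon^{-1}\eta|_{\mathcal L_\alpha}$, where $\eta\in\mathcal N$ is an element that maps $\mathcal L_\alpha$ to $\mathcal L_\beta$ with $\eta(e_\alpha)=\epsilon e_\beta$, $\epsilon\in\mathbb K^\times$ (this does not depend on $\eta$). Fix $\alpha\in R^\times$ and set $\mathcal A=\mathcal L_\alpha$, $\mathcal A^\lambda=\mathcal L_\alpha^\lambda$, and $e_\mu(a)=\theta_{\mu,\alpha}(a)$ for $a\in\mathcal A$, $\mu\in R^\times$. Fix an $A_2$-pair $(\beta,\gamma)$, i.e. linearly independent roots such that $(\mathbb Z\beta+\mathbb Z\gamma)\cap R$ is a root system of type $A_2$ with base $\{\beta,\gamma\}$. The coordinate algebra of $\mathcal L$ is $\mathcal A$ with the multiplication determined by $$[e_\beta(a),e_\gamma(b)]=N\,e_{\beta+\gamma}(ab)\qquad(a,b\in\mathcal A),$$ where $[e_\beta,e_\gamma]=N e_{\beta+\gamma}$, $N\in\mathbb K^\times$. **Proposition.** For every such choice of the Chevalley basis, $\alpha$ and $(\beta,\gamma)$, the coordinate algebra $\mathcal A=\bigoplus_{\lambda\in\Lambda}\mathcal A^\lambda$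 is a $\Lambda$-graded algebra, and it admits a pre-Chevalley (anti)-involution: there is a $\mathbb K$-linear map $\bar{\ }:\mathcal A\to\mathcal A$ with $\overline{ab}=\bar b\,\bar a$ and $\overline{\bar a}=a$ for all $a,b\in\mathcal A$, and $\overline{\mathcal A^\lambda}=\mathcal A^{-\lambda}$ for all $\lambda\in\Lambda$. -/

import Mathlib

open LieAlgebra LieModule

namespace RootGraded

/-! ### Graded algebras and anti-involutions -/

section GradedAlgebra

variable {K A Λ : Type*} [Field K] [AddCommGroup A] [Module K A] [AddCommGroup Λ]

/-- The (not necessarily associative) algebra with underlying space `A` and multiplication `m`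
is graded by `Λ`, with homogeneous components `𝒜 l`. -/
structure IsGradedAlgebra (m : A →ₗ[K] A →ₗ[K] A) (𝒜 : Λ → Submodule K A) : Prop where
  independent : iSupIndep 𝒜
  iSup_eq_top : (⨆ l, 𝒜 l) = ⊤
  mul_mem : ∀ l k : Λ, ∀ a ∈ 𝒜 l, ∀ b ∈ 𝒜 k, m a b ∈ 𝒜 (l + k)

/-- An (anti)-involution of the algebra `(A, m)`: a linear map that reverses products and squares
to the identity. -/
structure IsAntiInvolution (m : A →ₗ[K] A →ₗ[K] A) (bar : A →ₗ[K] A) : Prop where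
  map_mul : ∀ a b : A, bar (m a b) = m (bar b) (bar a)
  bar_bar : ∀ a : A, bar (bar a) = a

/-- A pre-Chevalley (anti)-involution of a `Λ`-graded algebra: an (anti)-involution that maps
the component of degree `l` onto the component of degree `-l`. -/
structure IsPreChevalley (m : A →ₗ[K] A →ₗ[K] A) (𝒜 : Λ → Submodule K A) (bar : A →ₗ[K] A) : Prop
    extends IsAntiInvolution m bar where
  map_component : ∀ l : Λ, (𝒜 l).map bar = 𝒜 (-l)

end GradedAlgebra

/-! ### Root-graded Lie algebras -/

section Weights

variable {K L : Type*} [Field K] [LieRing L] [LieAlgebra K L]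
  {g : LieSubalgebra K L} (H : LieSubalgebra K g)

/-- The simultaneous eigenspace `L_χ = {x ∈ L | [h, x] = χ(h) x for all h ∈ H}` of a
subalgebra `H` of a subalgebra `g` of `L`. -/
def component (χ : H → K) : Submodule K L where
  carrier := {x | ∀ h : H, ⁅((h : g) : L), x⁆ = χ h • x}
  add_mem' := by
    intro x y hx hy h
    rw [lie_add, hx h, hy h, smul_add]
  zero_mem' := by
    intro h
    rw [lie_zero, smul_zero]
  smul_mem' := by
    intro c x hx h
    rw [lie_smul, hx h, smul_comm]

/-- `L_χ ∩ L^l` for a family `ℒ l = L^l` of subspaces of `L`. -/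
def bicomponent {Λ : Type*} (ℒ : Λ → Submodule K L) (χ : H → K) (l : Λ) : Submodule K L :=
  component H χ ⊓ ℒ l

theorem lie_mem_component {χ ψ ω : H → K} (hω : ω = χ + ψ) {x y : L}
    (hx : x ∈ component H χ) (hy : y ∈ component H ψ) : ⁅x, y⁆ ∈ component H ω := by
  intro h
  rw [leibniz_lie, hx h, hy h, smul_lie, lie_smul, hω, Pi.add_apply, add_smul]

end Weights

section Gradings

variable {K L : Type*} [Field K] [CharZero K] [LieRing L] [LieAlgebra K L]
  {g : LieSubalgebra K L} [FiniteDimensional K g] [LieAlgebra.IsSimple K g]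
  (H : LieSubalgebra K g) [H.IsCartanSubalgebra] [IsTriangularizable K H g]

/-- `L` is graded by the root system `R` of `(g, H)`. The type `Weight K H g` consists of the
elements of `R`, including `0`, and the finite set `H.root` consists of the nonzero ones. -/
structure IsRootGraded : Prop where
  independent : iSupIndep fun α : Weight K H g => component H (α : H → K)
  iSup_eq_top : (⨆ α : Weight K H g, component H (α : H → K)) = ⊤
  zero_component : component H (0 : H → K) =
    ⨆ α ∈ H.root, Submodule.span K
      {z | ∃ x ∈ component H (α : H → K), ∃ y ∈ component H (-(α : H → K)), ⁅x, y⁆ = z}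

/-- The root system of `(g, H)` is simply-laced: Cartan integers of non-proportional roots are
`0`, `1` or `-1`. (It is irreducible and reduced as `g` is simple, and its rank is `dim H`.) -/
def IsSimplyLaced : Prop :=
  ∀ α β : H.root, (α : Weight K H g) ≠ β → (α : Weight K H g) ≠ -β →
    (IsKilling.rootSystem H).pairing α β = 0 ∨ (IsKilling.rootSystem H).pairing α β = 1 ∨
      (IsKilling.rootSystem H).pairing α β = -1

variable {Λ : Type*} [AddCommGroup Λ]

/-- `L` is `(R, Λ)`-graded: it is `R`-graded, and `ℒ` is a compatible `Λ`-grading. -/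
structure IsRootLatticeGraded (ℒ : Λ → Submodule K L) : Prop extends IsRootGraded H where
  grading_independent : iSupIndep ℒ
  grading_iSup_eq_top : (⨆ l, ℒ l) = ⊤
  lie_mem : ∀ l k : Λ, ∀ x ∈ ℒ l, ∀ y ∈ ℒ k, ⁅x, y⁆ ∈ ℒ (l + k)
  le_zero : g.toSubmodule ≤ ℒ 0
  closure_support : AddSubgroup.closure {l : Λ | ℒ l ≠ ⊥} = ⊤

/-- `L` is division `(R, Λ)`-graded. -/
structure IsDivisionGraded (ℒ : Λ → Submodule K L) : Prop extends IsRootLatticeGraded H ℒ where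
  exists_inverse : ∀ α ∈ H.root, ∀ l : Λ, ∀ x ∈ bicomponent H ℒ (α : H → K) l, x ≠ 0 →
    ∃ y ∈ bicomponent H ℒ (-(α : H → K)) (-l),
      ∀ β : Weight K H g, ∀ z ∈ component H (β : H → K),
        ⁅⁅x, y⁆, z⁆ = β (IsKilling.coroot α) • z

/-- `τ` is a Chevalley involution of the `(R, Λ)`-graded Lie algebra `(L, g, H)`. -/
structure IsChevalleyInvolution (ℒ : Λ → Submodule K L) (τ : L ≃ₗ⁅K⁆ L) : Prop where
  apply_apply : ∀ x : L, τ (τ x) = x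
  map_subalgebra : g.map (τ : L →ₗ⁅K⁆ L) = g
  map_grading : ∀ l : Λ, (ℒ l).map (τ : L →ₗ[K] L) = ℒ (-l)
  apply_eq_neg : ∀ x ∈ bicomponent H ℒ (0 : H → K) 0, τ x = -x

end Gradings

/-! ### Chevalley bases and the coordinate algebra -/

section Coordinates

variable {K L : Type*} [Field K] [CharZero K] [LieRing L] [LieAlgebra K L]
  {g : LieSubalgebra K L} [FiniteDimensional K g] [LieAlgebra.IsSimple K g]
  {H : LieSubalgebra K g} [H.IsCartanSubalgebra] [IsTriangularizable K H g]

/-- The vectors `e α` (`α` a nonzero root) are the root vectors of a Chevalley basis of `g`: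
`e α ∈ g_α`, `[e α, e (-α)]` is the coroot of `α`, and if `[e α, e β] = c e (α + β)` then
`[e (-α), e (-β)] = -c e (-α - β)`. (The remaining members of the basis are the coroots of the
simple roots of a base. The value of `e` at the weight `0` is irrelevant.) -/
structure IsChevalleyBasis (e : Weight K H g → g) : Prop where
  mem_rootSpace : ∀ α ∈ H.root, e α ∈ rootSpace H (α : H → K)
  lie_neg : ∀ α ∈ H.root, ⁅e α, e (-α)⁆ = ((IsKilling.coroot α : H) : g)
  lie_add : ∀ α ∈ H.root, ∀ β ∈ H.root, ∀ δ ∈ H.root, (δ : H → K) = α + β →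
    ∃ c : K, ⁅e α, e β⁆ = c • e δ ∧ ⁅e (-α), e (-β)⁆ = -c • e (-δ)

/-- The exponential `∑ fⁿ / n!` of a nilpotent endomorphism `f` (a finite sum). -/
noncomputable def expNilpotent (f : Module.End K L) : Module.End K L :=
  ∑ n ∈ Finset.range (nilpotencyClass f), ((n.factorial : K)⁻¹) • f ^ n

/-- `Ad η_α(t) = exp(ad t e_α) exp(ad (-t⁻¹ e_{-α})) exp(ad t e_α)`, acting on `L`. -/
noncomputable def adEta (e : Weight K H g → g) (α : Weight K H g) (t : K) : Module.End K L :=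
  expNilpotent (LieAlgebra.ad K L (t • (e α : L))) *
    expNilpotent (LieAlgebra.ad K L (-t⁻¹ • (e (-α) : L))) *
      expNilpotent (LieAlgebra.ad K L (t • (e α : L)))

/-- The image under `Ad` of the group `𝒩` generated by the elements `η_α(t)`, where `α` is a
nonzero root and `t ∈ Kˣ`. -/
def adN (e : Weight K H g → g) : Subgroup (L ≃ₗ[K] L) :=
  Subgroup.closure
    {u | ∃ α ∈ H.root, ∃ t : K, t ≠ 0 ∧ (u : L →ₗ[K] L) = adEta e α t}

open Classical in
/-- The transfer map `θ_{β, α} : L_α → L_β`, `θ_{β, α} = ε⁻¹ Ad(η)`, where `η ∈ 𝒩` is chosen such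
that it maps `L_α` to `L_β`, and `Ad(η) e_α = ε e_β` with `ε ≠ 0`. (Such `η` are those
representing the Weyl group elements that map `α` to `β`; the map does not depend on the choice of
`η`.) -/
noncomputable def theta (e : Weight K H g → g) (β α : Weight K H g) :
    component H (α : H → K) →ₗ[K] component H (β : H → K) :=
  if h : ∃ p : (L ≃ₗ[K] L) × K, p.1 ∈ adN e ∧ p.2 ≠ 0 ∧ p.1 (e α : L) = p.2 • (e β : L) ∧
      ∀ x ∈ component H (α : H → K), (p.1 : L →ₗ[K] L) x ∈ component H (β : H → K)
  then h.choose.2⁻¹ • (h.choose.1 : L →ₗ[K] L).restrict h.choose_spec.2.2.2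
  else 0

/-- `(β, γ)` is an `A₂`-pair: `β` and `γ` are linearly independent roots, and the roots in
`ℤβ + ℤγ` form a root system of type `A₂` with base `{β, γ}`. -/
structure IsA2Pair (β γ : Weight K H g) : Prop where
  left_mem : β ∈ H.root
  right_mem : γ ∈ H.root
  linearIndependent : LinearIndependent K ![(β : H → K), (γ : H → K)]
  roots_eq : {χ : H → K | (∃ δ ∈ H.root, (δ : H → K) = χ) ∧
      ∃ m n : ℤ, χ = m • (β : H → K) + n • (γ : H → K)} =
    {(β : H → K), (γ : H → K), (β : H → K) + γ, -(β : H → K), -(γ : H → K), -((β : H → K) + γ)}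

open Classical in
/-- The structure constant `N` with `[e_β, e_γ] = N e_δ`, where `δ = β + γ`. -/
noncomputable def structureConstant (e : Weight K H g → g) (β γ δ : Weight K H g) : K :=
  if h : ∃ c : K, ⁅e β, e γ⁆ = c • e δ then h.choose else 0

/-- The multiplication `(a, b) ↦ ab` of the coordinate algebra `𝒜`, realized on the vector space
`L_α`, with respect to the pair `(β, γ)` with `δ = β + γ`. With `e_μ(a) = θ_{μ, α}(a)`, it is given
by `[e_β(a), e_γ(b)] = N e_δ(ab)`, where `[e_β, e_γ] = N e_δ`; that is,
`ab = N⁻¹ θ_{α, δ} [θ_{β, α}(a), θ_{γ, α}(b)]`, as `θ_{α, δ}` is the inverse of `θ_{δ, α}`. -/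
noncomputable def coordinateMul (e : Weight K H g → g) (α β γ δ : Weight K H g)
    (hδ : (δ : H → K) = β + γ) :
    component H (α : H → K) →ₗ[K] component H (α : H → K) →ₗ[K] component H (α : H → K) :=
  (structureConstant e β γ δ)⁻¹ • LinearMap.mk₂ K
    (fun a b => theta e α δ
      ⟨⁅(theta e β α a : L), (theta e γ α b : L)⁆,
        lie_mem_component H hδ (theta e β α a).2 (theta e γ α b).2⟩)
    (by
      intro a a' b
      rw [← map_add]
      congr 1
      ext
      simp)
    (by
      intro c a b
      rw [← map_smul]
      congr 1
      ext
      simp)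
    (by
      intro a b b'
      rw [← map_add]
      congr 1
      ext
      simp)
    (by
      intro c a b
      rw [← map_smul]
      congr 1
      ext
      simp)

/-- The homogeneous component `𝒜^l = L_α^l` of the coordinate algebra `𝒜 = L_α`. -/
def coordinateComponent {Λ : Type*} (ℒ : Λ → Submodule K L) (α : Weight K H g) (l : Λ) :
    Submodule K (component H (α : H → K)) :=
  (bicomponent H ℒ (α : H → K) l).submoduleOf (component H (α : H → K))

end Coordinates

end RootGraded

set_option linter.unusedSectionVars false

namespace RootGraded

/-! ### Weight-graded modules -/

section WeightModules

variable {K 𝔤 : Type*} [Field K] [CharZero K] [LieRing 𝔤] [LieAlgebra K 𝔤]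
  [FiniteDimensional K 𝔤] [LieAlgebra.IsSimple K 𝔤]
  (H : LieSubalgebra K 𝔤) [H.IsCartanSubalgebra] [IsTriangularizable K H 𝔤]
  (M : Type*) [AddCommGroup M] [Module K M] [LieRingModule 𝔤 M] [LieModule K 𝔤 M]

/-! Regard `L` as a `g`-module by the adjoint action. All its weights lie in the root system `R`,
and `R` is simply-laced. The crucial fact (`exists_hom`, `hom_ext`) is that each `x ∈ L_α` is `φ (e
α)` for exactly one `g`-homomorphism `φ : g → L`. Evaluation at `e α` thus identifies the coordinate
algebra with `Hom_g(g, L)` (`homEquiv`), which involves no choice of root.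

Existence of `φ`: let `T ⊆ g × L` be the submodule generated by `(e α, x)`; it must be shown to be a
graph over `g`. It projects onto `g` by simplicity. Its `α`-weight space is spanned by the generator
(`lieSpan_le_span_sup`), so the kernel has no weight `α`, and by `root_induction` with
`sl₂`-computations no nonzero weight at all. Hence `g` acts trivially on the kernel. Since `T` is
perfect and `H¹(g, g*) = 0`, the kernel vanishes (`injective_of_trivial_kernel`).

Elements of `adN` are built from exponentials of `ad z` with `z ∈ g`, so they satisfy `u ∘ φ = φ ∘
v` with one `v` for all `φ`. Hence the transfer maps send `φ (e α)` to `φ (e β)` (`theta_apply`),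
and the product `χ` of `φ` and `ψ` is given by `[φ(e_β), ψ(e_γ)] = N χ(e_δ)`. Homomorphisms respect
degrees because `g ⊆ L⁰`, which makes the algebra graded.

The involution is `φ ↦ τ ∘ φ ∘ τ|_g`. It reverses products (`lie_conj`): with `f = e_{-δ}`, the
operator `(ad f)²` carries the equation above to one between vectors of weights `-γ`, `-β` and `-δ`,
and `τ` carries these to `γ`, `β` and `δ`. The roles of `β` and `γ` are now exchanged. The scalars
do not depend on `φ`, `ψ`, `χ`, so they can be read off from the inclusion `g → L`, which `τ` fixes.
-/

/-- The simultaneous eigenspace of weight `χ` of the subalgebra `H` in a module over the ambient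
Lie algebra, as a subspace. -/
def weightSubspace (χ : H → K) : Submodule K M := (weightSpace M χ).toSubmodule

/-- The module is the sum of its weight spaces for the weights of the adjoint module. -/
def IsWeightGraded : Prop := (⨆ ν : Weight K H 𝔤, weightSubspace H M (ν : H → K)) = ⊤

variable {H M}

theorem mem_weightSubspace {χ : H → K} {m : M} :
    m ∈ weightSubspace H M χ ↔ ∀ h : H, ⁅(h : 𝔤), m⁆ = χ h • m := by
  rw [weightSubspace, LieSubmodule.mem_toSubmodule, mem_weightSpace]
  rfl

theorem mem_weightSubspace_adjoint {χ : H → K} {x : 𝔤} :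
    x ∈ weightSubspace H 𝔤 χ ↔ x ∈ rootSpace H χ := by
  refine ⟨fun hx => weightSpace_le_genWeightSpace 𝔤 χ hx, fun hx => ?_⟩
  rw [mem_weightSubspace]
  exact fun h => IsKilling.lie_eq_smul_of_mem_rootSpace hx h

theorem lie_mem_weightSubspace {χ ψ ω : H → K} (hω : ω = χ + ψ) {y : 𝔤} {m : M}
    (hy : y ∈ weightSubspace H 𝔤 χ) (hm : m ∈ weightSubspace H M ψ) :
    ⁅y, m⁆ ∈ weightSubspace H M ω := by
  rw [mem_weightSubspace] at *
  intro h
  rw [leibniz_lie, hy h, hm h, smul_lie, lie_smul, hω, Pi.add_apply, add_smul]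

theorem map_mem_weightSubspace {N : Type*} [AddCommGroup N] [Module K N] [LieRingModule 𝔤 N]
    [LieModule K 𝔤 N] (φ : M →ₗ⁅K,𝔤⁆ N) {χ : H → K} {m : M} (hm : m ∈ weightSubspace H M χ) :
    φ m ∈ weightSubspace H N χ := by
  rw [mem_weightSubspace] at *
  intro h
  rw [← LieModuleHom.map_lie, hm h, map_smul]

variable (H M) in
theorem iSupIndep_weightSubspace : iSupIndep fun χ : H → K => weightSubspace H M χ := by
  have h := iSupIndep_genWeightSpace K H M
  rw [← LieSubmodule.iSupIndep_toSubmodule] at h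
  exact h.mono fun χ => weightSpace_le_genWeightSpace M χ

variable (H M) in
theorem iSupIndep_weightSubspace_weight :
    iSupIndep fun ν : Weight K H 𝔤 => weightSubspace H M (ν : H → K) :=
  (iSupIndep_weightSubspace H M).comp DFunLike.coe_injective

/-- A vector whose weight is not a weight of the adjoint module vanishes. -/
theorem IsWeightGraded.eq_zero_of_forall_ne (hM : IsWeightGraded H M) {χ : H → K}
    (hχ : ∀ ν : Weight K H 𝔤, (ν : H → K) ≠ χ) {m : M} (hm : m ∈ weightSubspace H M χ) :
    m = 0 := by
  refine Submodule.disjoint_def.1 (iSupIndep_weightSubspace H M χ) m hm ?_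
  have : (⊤ : Submodule K M) ≤ ⨆ (ψ : H → K) (_ : ψ ≠ χ), weightSubspace H M ψ := by
    rw [← hM]
    exact iSup_le fun ν => le_iSup₂_of_le (ν : H → K) (hχ ν) le_rfl
  exact this trivial

variable (H) in
theorem isWeightGraded_adjoint : IsWeightGraded H 𝔤 := by
  have h := iSup_genWeightSpace_eq_top' K H 𝔤
  rw [← LieSubmodule.toSubmodule_inj, LieSubmodule.iSup_toSubmodule,
    LieSubmodule.top_toSubmodule] at h
  rw [IsWeightGraded, ← h]
  congr 1
  ext ν x
  exact mem_weightSubspace_adjoint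

/-- A subspace that is stable under all weight vectors of the Lie algebra is stable under the
Lie algebra. -/
theorem lie_mem_of_forall_weight {N : Submodule K M} {m : M}
    (h : ∀ μ : Weight K H 𝔤, ∀ y ∈ weightSubspace H 𝔤 (μ : H → K), ⁅y, m⁆ ∈ N) (y : 𝔤) :
    ⁅y, m⁆ ∈ N := by
  have hy : y ∈ ⨆ ν : Weight K H 𝔤, weightSubspace H 𝔤 (ν : H → K) := by
    rw [isWeightGraded_adjoint H]; trivial
  induction hy using Submodule.iSup_induction' with
  | mem ν y hy => exact h ν y hy
  | zero => rw [zero_lie]; exact N.zero_mem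
  | add y z _ _ hy hz => rw [add_lie]; exact N.add_mem hy hz

theorem mem_of_mem_weightSubspace_zero {x : 𝔤} (hx : x ∈ weightSubspace H 𝔤 (0 : H → K)) :
    x ∈ H := by
  rw [mem_weightSubspace_adjoint] at hx
  rwa [← LieSubalgebra.mem_toLieSubmodule, ← rootSpace_zero_eq K 𝔤 H]

/-! ### Generation of homomorphisms by extremal weight vectors -/

/-- The Cartan integers of non-proportional roots are `0`, `1` or `-1`. -/
def HasSimplyLacedRoots (H : LieSubalgebra K 𝔤) [H.IsCartanSubalgebra]
    [IsTriangularizable K H 𝔤] : Prop :=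
  ∀ μ ν : Weight K H 𝔤, μ.IsNonZero → ν.IsNonZero → μ ≠ ν → μ ≠ -ν →
    μ (IsKilling.coroot ν) = 0 ∨ μ (IsKilling.coroot ν) = 1 ∨ μ (IsKilling.coroot ν) = -1

theorem HasSimplyLacedRoots.apply_coroot (hS : HasSimplyLacedRoots H) (μ : Weight K H 𝔤)
    {ν : Weight K H 𝔤} (hν : ν.IsNonZero) :
    μ (IsKilling.coroot ν) = 0 ∨ μ (IsKilling.coroot ν) = 1 ∨ μ (IsKilling.coroot ν) = -1 ∨
      (μ = ν ∧ μ (IsKilling.coroot ν) = 2) ∨ (μ = -ν ∧ μ (IsKilling.coroot ν) = -2) := by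
  by_cases hμ : μ.IsZero
  · left
    rw [hμ.eq]; rfl
  by_cases h1 : μ = ν
  · subst h1
    simp [IsKilling.root_apply_coroot hν]
  by_cases h2 : μ = -ν
  · subst h2
    have := IsKilling.root_apply_coroot hν
    simp [this]
  have := hS μ ν hμ hν h1 h2
  tauto

/-- A functional other than the root `ν` whose value on the coroot of `ν` is at least `2` is not
a weight. -/
theorem HasSimplyLacedRoots.ne_of_apply_coroot (hS : HasSimplyLacedRoots H) {χ : H → K}
    {ν : Weight K H 𝔤} (hν : ν.IsNonZero) {n : ℕ}
    (hχ : χ (IsKilling.coroot ν) = n + 2) (hne : χ ≠ ν) (μ : Weight K H 𝔤) :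
    (μ : H → K) ≠ χ := by
  rintro rfl
  rcases hS.apply_coroot μ hν with h | h | h | ⟨h, -⟩ | ⟨-, h⟩
  · rw [h] at hχ; norm_cast at hχ
  · rw [h] at hχ; norm_cast at hχ; omega
  · rw [h] at hχ
    have : ((n + 3 : ℕ) : K) = 0 := by push_cast; linear_combination -hχ
    norm_cast at this
  · exact hne (by rw [h])
  · rw [h] at hχ
    have : ((n + 4 : ℕ) : K) = 0 := by push_cast; linear_combination -hχ
    norm_cast at this

end WeightModules

/-! ### Cyclic submodules generated by a vector of root weight, and extensions by trivial modules.
-/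

section ExtremalVectors

variable {K 𝔤 : Type*} [Field K] [CharZero K] [LieRing 𝔤] [LieAlgebra K 𝔤]
  [FiniteDimensional K 𝔤] [LieAlgebra.IsSimple K 𝔤]
  {H : LieSubalgebra K 𝔤} [H.IsCartanSubalgebra] [IsTriangularizable K H 𝔤]
  {M : Type*} [AddCommGroup M] [Module K M] [LieRingModule 𝔤 M] [LieModule K 𝔤 M]

/-- The submodule generated by a weight vector is the sum of its weight spaces. -/
theorem IsWeightGraded.lieSpan_le_iSup (hM : IsWeightGraded H M) {α : Weight K H 𝔤} {w : M}
    (hw : w ∈ weightSubspace H M (α : H → K)) :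
    (LieSubmodule.lieSpan K 𝔤 {w}).toSubmodule ≤
      ⨆ ν : Weight K H 𝔤, (LieSubmodule.lieSpan K 𝔤 {w}).toSubmodule ⊓
        weightSubspace H M (ν : H → K) := by
  set T := LieSubmodule.lieSpan K 𝔤 {w} with hT
  set N := ⨆ ν : Weight K H 𝔤, T.toSubmodule ⊓ weightSubspace H M (ν : H → K) with hN
  have hstable : ∀ (y : 𝔤) {m : M}, m ∈ N → ⁅y, m⁆ ∈ N := by
    intro y m hm
    induction hm using Submodule.iSup_induction' with
    | mem ν m hm =>
      refine lie_mem_of_forall_weight (H := H) (fun μ y hy => ?_) y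
      have hmem := lie_mem_weightSubspace (rfl : (μ : H → K) + ν = μ + ν) hy hm.2
      by_cases h : ∃ ρ : Weight K H 𝔤, (ρ : H → K) = μ + ν
      · obtain ⟨ρ, hρ⟩ := h
        rw [← hρ] at hmem
        exact Submodule.mem_iSup_of_mem ρ ⟨T.lie_mem hm.1, hmem⟩
      · push Not at h
        rw [hM.eq_zero_of_forall_ne h hmem]
        exact N.zero_mem
    | zero => rw [lie_zero]; exact N.zero_mem
    | add y z _ _ hy hz => rw [lie_add]; exact N.add_mem hy hz
  let N' : LieSubmodule K 𝔤 M := { N with lie_mem := fun {y m} hm => hstable y hm }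
  have : T ≤ N' := by
    rw [hT, LieSubmodule.lieSpan_le, Set.singleton_subset_iff]
    exact Submodule.mem_iSup_of_mem α ⟨LieSubmodule.subset_lieSpan rfl, hw⟩
  exact this

/-- In the submodule generated by a vector whose weight is a root, that vector spans its
weight space. -/
theorem IsWeightGraded.lieSpan_le_span_sup (hS : HasSimplyLacedRoots H) (hM : IsWeightGraded H M)
    {α : Weight K H 𝔤} (hα : α.IsNonZero) {w : M} (hw : w ∈ weightSubspace H M (α : H → K)) :
    (LieSubmodule.lieSpan K 𝔤 {w}).toSubmodule ≤
      K ∙ w ⊔ ⨆ (ν : Weight K H 𝔤) (_ : ν ≠ α), weightSubspace H M (ν : H → K) := by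
  set U := K ∙ w ⊔ ⨆ (ν : Weight K H 𝔤) (_ : ν ≠ α), weightSubspace H M (ν : H → K) with hU
  -- Root vectors with negative value on the coroot of `α` serve as lowering operators. `W` is the
  -- smallest subspace containing `w` and stable under them; it turns out to be the whole generated
  -- submodule, which replaces an appeal to Poincaré–Birkhoff–Witt.
  let IsNeg : Weight K H 𝔤 → Prop := fun μ =>
    μ (IsKilling.coroot α) = -1 ∨ μ (IsKilling.coroot α) = -2
  let C : Set (Submodule K M) := {N | w ∈ N ∧ ∀ μ : Weight K H 𝔤, IsNeg μ →
    ∀ y ∈ weightSubspace H 𝔤 (μ : H → K), ∀ m ∈ N, ⁅y, m⁆ ∈ N}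
  set W := sInf C with hW
  have hwW : w ∈ W := (Submodule.mem_sInf).2 fun N hN => hN.1
  have hnW : ∀ μ : Weight K H 𝔤, IsNeg μ →
      ∀ y ∈ weightSubspace H 𝔤 (μ : H → K), ∀ m ∈ W, ⁅y, m⁆ ∈ W := by
    intro μ hμ y hy m hm
    rw [hW, Submodule.mem_sInf] at hm ⊢
    exact fun N hN => hN.2 μ hμ y hy m (hm N hN)
  have h2 := IsKilling.root_apply_coroot hα
  -- The Cartan subalgebra scales `w`. A root vector with nonnegative value would send `w` to a
  -- functional with value at least `2` on the coroot but different from `α`, which is not a weight.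
  have hpw : ∀ p : 𝔤, ⁅p, w⁆ ∈ W := by
    refine lie_mem_of_forall_weight (H := H) fun μ y hy => ?_
    by_cases hμ0 : μ.IsZero
    · rw [hμ0.eq] at hy
      have := (mem_weightSubspace.1 hw) ⟨y, mem_of_mem_weightSubspace_zero hy⟩
      simp only at this
      rw [this]
      exact W.smul_mem _ hwW
    have hmem := lie_mem_weightSubspace (rfl : (μ : H → K) + α = μ + α) hy hw
    have hvan : ∀ n : ℕ, μ (IsKilling.coroot α) = n → ⁅y, w⁆ ∈ W := by
      intro n hn
      rw [hM.eq_zero_of_forall_ne (hS.ne_of_apply_coroot hα (n := n) _ _) hmem]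
      · exact W.zero_mem
      · rw [Pi.add_apply, h2, hn]
      · intro h
        exact hμ0 (by simpa using h)
    rcases hS.apply_coroot μ hα with h | h | h | ⟨-, h⟩ | ⟨-, h⟩
    · exact hvan 0 (by simp [h])
    · exact hvan 1 (by simp [h])
    · exact hnW μ (Or.inl h) y hy w hwW
    · exact hvan 2 (by simp [h])
    · exact hnW μ (Or.inr h) y hy w hwW
  -- By the Leibniz rule `S` is again stable under the lowering operators, so minimality gives `W ≤
  -- S`; thus `W` is a submodule.
  let S : Submodule K M :=
    { carrier := {m | m ∈ W ∧ ∀ p : 𝔤, ⁅p, m⁆ ∈ W}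
      add_mem' := fun {a b} ha hb => ⟨W.add_mem ha.1 hb.1, fun p => by
        rw [lie_add]; exact W.add_mem (ha.2 p) (hb.2 p)⟩
      zero_mem' := ⟨W.zero_mem, fun p => by rw [lie_zero]; exact W.zero_mem⟩
      smul_mem' := fun c a ha => ⟨W.smul_mem c ha.1, fun p => by
        rw [lie_smul]; exact W.smul_mem c (ha.2 p)⟩ }
  have hSC : S ∈ C := by
    refine ⟨⟨hwW, hpw⟩, fun μ hμ y hy m hm => ⟨hm.2 y, fun p => ?_⟩⟩
    rw [leibniz_lie]
    exact W.add_mem (hm.2 _) (hnW μ hμ y hy _ (hm.2 p))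
  have hWS : W ≤ S := sInf_le hSC
  let W' : LieSubmodule K 𝔤 M := { W with lie_mem := fun {y m} hm => (hWS hm).2 y }
  have hTW : LieSubmodule.lieSpan K 𝔤 {w} ≤ W' := by
    rw [LieSubmodule.lieSpan_le, Set.singleton_subset_iff]
    exact hwW
  have hle : ∀ χ : H → K, χ ≠ α → weightSubspace H M χ ≤ U := by
    intro χ hχ m hm
    by_cases h : ∃ ρ : Weight K H 𝔤, (ρ : H → K) = χ
    · obtain ⟨ρ, rfl⟩ := h
      refine (le_sup_right : _ ≤ U) (Submodule.mem_iSup_of_mem ρ (Submodule.mem_iSup_of_mem ?_ hm))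
      rintro rfl
      exact hχ rfl
    · push Not at h
      rw [hM.eq_zero_of_forall_ne h hm]
      exact U.zero_mem
  have hUC : U ∈ C := by
    refine ⟨(le_sup_left : _ ≤ U) (Submodule.mem_span_singleton_self w), fun μ hμ y hy m hm => ?_⟩
    have hUle : U ≤ U.comap (toEnd K 𝔤 M y) := by
      rw [hU]
      refine sup_le ?_ (iSup₂_le fun ν hν m hm => ?_)
      · rw [Submodule.span_singleton_le_iff_mem]
        refine hle _ ?_ (lie_mem_weightSubspace (rfl : (μ : H → K) + α = μ + α) hy hw)
        intro h
        have h0 : (μ : H → K) = 0 := by simpa using h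
        have h1 : μ (IsKilling.coroot α) = 0 := congrFun h0 _
        rcases hμ with h | h <;> rw [h1] at h <;> norm_num at h
      · refine hle _ ?_ (lie_mem_weightSubspace (rfl : (μ : H → K) + ν = μ + ν) hy hm)
        intro h
        -- Returning to weight `α` by a lowering operator would require `ν` to have value `3` or `4`
        -- on the coroot of `α`.
        have h1 : μ (IsKilling.coroot α) + ν (IsKilling.coroot α) = 2 := by
          rw [← h2, ← h]; rfl
        rcases hμ with h | h
        · refine hS.ne_of_apply_coroot hα (χ := ν) (n := 1) ?_ ?_ ν rfl
          · push_cast; linear_combination h1 - h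
          · exact fun h => hν (DFunLike.coe_injective h)
        · refine hS.ne_of_apply_coroot hα (χ := ν) (n := 2) ?_ ?_ ν rfl
          · push_cast; linear_combination h1 - h
          · exact fun h => hν (DFunLike.coe_injective h)
    exact hUle hm
  exact (show (LieSubmodule.lieSpan K 𝔤 {w}).toSubmodule ≤ W from hTW).trans (sInf_le hUC)

/-! ### Trivial extensions of the adjoint module -/

/-- The first cohomology of the coadjoint module vanishes. -/
theorem exists_eq_apply_lie_of_cocycle (B : 𝔤 →ₗ[K] 𝔤 →ₗ[K] K)
    (hB : ∀ x y z : 𝔤, B ⁅x, y⁆ z = B x ⁅y, z⁆ - B y ⁅x, z⁆) :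
    ∃ f : 𝔤 →ₗ[K] K, ∀ x z : 𝔤, B x z = f ⁅x, z⁆ := by
  have hnd := IsKilling.killingForm_nondegenerate K 𝔤
  -- The Killing form turns the cocycle `𝔤 → 𝔤*` into a derivation of `𝔤`, which is inner.
  let e := (killingForm K 𝔤).toDual hnd
  let D : 𝔤 →ₗ[K] 𝔤 := e.symm.toLinearMap ∘ₗ B
  have hD : ∀ x z, killingForm K 𝔤 (D x) z = B x z := by
    intro x z
    exact LinearMap.BilinForm.apply_toDual_symm_apply (hB := hnd) (B x) z
  have hinv : ∀ x y z : 𝔤, killingForm K 𝔤 ⁅x, y⁆ z = killingForm K 𝔤 x ⁅y, z⁆ := fun x y z =>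
    LieModule.traceForm_apply_lie_apply K 𝔤 𝔤 x y z
  let D' : LieDerivation K 𝔤 𝔤 :=
    { D with
      leibniz' := by
        intro x y
        have : ∀ z, killingForm K 𝔤 (D ⁅x, y⁆ - (⁅x, D y⁆ - ⁅y, D x⁆)) z = 0 := by
          intro z
          rw [← lie_skew x (D y), ← lie_skew y (D x)]
          simp only [map_sub, map_neg, LinearMap.sub_apply, LinearMap.neg_apply, hinv, hD, hB]
          ring
        exact sub_eq_zero.1 (hnd.1 _ this) }
  obtain ⟨a, ha⟩ := LieDerivation.IsKilling.exists_eq_ad D'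
  refine ⟨killingForm K 𝔤 a, fun x z => ?_⟩
  rw [← hD, ← hinv]
  congr 2
  have := congrArg (fun d : LieDerivation K 𝔤 𝔤 => d x) ha
  exact this.symm.trans (LieDerivation.ad_apply_apply K 𝔤 a x)

/-- A perfect extension of the adjoint module by a trivial module is an isomorphism. -/
theorem injective_of_trivial_kernel (π : M →ₗ⁅K,𝔤⁆ 𝔤) (hπ : Function.Surjective π)
    (hker : ∀ m, π m = 0 → ∀ y : 𝔤, ⁅y, m⁆ = 0)
    (hperf : ∀ l : M →ₗ[K] K, (∀ (y : 𝔤) (m : M), l ⁅y, m⁆ = 0) → l = 0) :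
    Function.Injective π := by
  rw [injective_iff_map_eq_zero]
  intro z hz
  obtain ⟨s, hs⟩ := (π : M →ₗ[K] 𝔤).exists_rightInverse_of_surjective
    (LinearMap.range_eq_top.2 hπ)
  have hs' : ∀ y, π (s y) = y := fun y => LinearMap.congr_fun hs y
  -- As the kernel is a trivial module, the action on `s (π m)` does not depend on the linear
  -- section `s`. This makes `B` below a cocycle, hence a coboundary `f`.
  have hlie : ∀ (x : 𝔤) (m : M), ⁅x, s (π m)⁆ = ⁅x, m⁆ := by
    intro x m
    rw [← sub_eq_zero, ← lie_sub]
    exact hker _ (by rw [map_sub, hs', sub_self]) x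
  refine (Module.forall_dual_apply_eq_zero_iff K z).1 fun l => ?_
  let B : 𝔤 →ₗ[K] 𝔤 →ₗ[K] K := LinearMap.mk₂ K (fun x y => l ⁅x, s y⁆)
    (by simp) (by simp) (by simp) (by simp)
  have hBs : ∀ (x : 𝔤) (m : M), B x (π m) = l ⁅x, m⁆ := fun x m => congrArg l (hlie x m)
  obtain ⟨f, hf⟩ := exists_eq_apply_lie_of_cocycle B (by
    intro x y z
    obtain ⟨m, rfl⟩ := hπ z
    rw [← LieModuleHom.map_lie, ← LieModuleHom.map_lie, hBs, hBs, hBs, lie_lie, map_sub])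
  -- `l - f ∘ π` vanishes on all brackets, hence everywhere; so `l` vanishes on the kernel of `π`.
  have := hperf (l - f ∘ₗ (π : M →ₗ[K] 𝔤)) (by
    intro y m
    have h1 := hf y (π m)
    rw [hBs, ← LieModuleHom.map_lie] at h1
    simp only [LinearMap.sub_apply, LinearMap.comp_apply]
    rw [h1]
    exact sub_self _)
  have h1 := LinearMap.congr_fun this z
  have h2 : f (π z) = 0 := by rw [hz, map_zero]
  simp only [LinearMap.sub_apply, LinearMap.comp_apply, LinearMap.zero_apply] at h1
  exact (sub_eq_zero.1 h1).trans h2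

end ExtremalVectors

/-! ### Induction over the roots of a simply-laced system. -/

section RootInduction

variable {K 𝔤 : Type*} [Field K] [CharZero K] [LieRing 𝔤] [LieAlgebra K 𝔤]
  [FiniteDimensional K 𝔤] [LieAlgebra.IsSimple K 𝔤]
  {H : LieSubalgebra K 𝔤} [H.IsCartanSubalgebra] [IsTriangularizable K H 𝔤]

theorem coe_reflectRoot (μ ν : Weight K H 𝔤) :
    (IsKilling.reflectRoot ν μ : H → K) = (μ : H → K) - μ (IsKilling.coroot ν) • (ν : H → K) :=
  rfl

theorem mem_root_iff {μ : Weight K H 𝔤} : μ ∈ H.root ↔ μ.IsNonZero := by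
  simp

/-- The opposite integer is nonzero along with `c`. Were it `-c`, the root `μ - cν` would take the
value `2 + c² = 3` on the coroot of `μ`. -/
theorem HasSimplyLacedRoots.apply_coroot_symm (hS : HasSimplyLacedRoots H) {μ ν : Weight K H 𝔤}
    (hμ : μ.IsNonZero) (hν : ν.IsNonZero) {c : K} (hc : μ (IsKilling.coroot ν) = c)
    (hc' : c = 1 ∨ c = -1) (h1 : μ ≠ ν) (h2 : μ ≠ -ν) : ν (IsKilling.coroot μ) = c := by
  have h3 : ν ≠ -μ := fun h => h2 (by rw [h, neg_neg])
  have hne : ν (IsKilling.coroot μ) ≠ 0 := by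
    intro h
    have h4 := ((IsKilling.rootSystem H).pairing_eq_zero_iff'
      (i := ⟨ν, mem_root_iff.2 hν⟩) (j := ⟨μ, mem_root_iff.2 hμ⟩)).1 h
    have h5 : c = 0 := hc.symm.trans h4
    rcases hc' with h | h <;> rw [h] at h5 <;> norm_num at h5
  by_contra hd
  have hd' : ν (IsKilling.coroot μ) = -c := by
    rcases hS ν μ hν hμ h1.symm h3 with h | h | h
    · exact absurd h hne
    · rcases hc' with rfl | rfl
      · exact absurd h hd
      · simp [h]
    · rcases hc' with rfl | rfl
      · exact h
      · exact absurd h hd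
  have hcc : c * c = 1 := by rcases hc' with rfl | rfl <;> norm_num
  refine hS.ne_of_apply_coroot hμ (χ := IsKilling.reflectRoot ν μ) (n := 1) ?_ ?_ _ rfl
  · simp only [coe_reflectRoot, Pi.sub_apply, Pi.smul_apply, smul_eq_mul, hc, hd',
      IsKilling.root_apply_coroot hμ]
    push_cast
    linear_combination hcc
  · intro h
    rw [coe_reflectRoot, sub_eq_self, hc] at h
    refine hν ((smul_eq_zero.1 h).resolve_left ?_)
    rintro rfl
    norm_num at hcc

/-- A property of the roots of a simply-laced system that passes from `μ` to the reflections of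
`μ` holds for all roots as soon as it holds for one. -/
theorem HasSimplyLacedRoots.root_induction (hS : HasSimplyLacedRoots H)
    {P : Weight K H 𝔤 → Prop} {α : Weight K H 𝔤} (hα : α.IsNonZero) (h0 : P α)
    (hneg : ∀ ν : Weight K H 𝔤, ν.IsNonZero → P ν → P (-ν))
    (hsub : ∀ μ ν ρ : Weight K H 𝔤, μ.IsNonZero → ν.IsNonZero → ρ.IsNonZero →
      μ (IsKilling.coroot ν) = 1 → (ρ : H → K) = μ - ν → P μ → P ρ)
    {μ : Weight K H 𝔤} (hμ : μ.IsNonZero) : P μ := by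
  have hrefl : ∀ μ ν : Weight K H 𝔤, μ.IsNonZero → ν.IsNonZero → P μ →
      P (IsKilling.reflectRoot ν μ) := by
    intro μ ν hμ hν hP
    have hρ := IsKilling.reflectRoot_isNonZero ν μ hμ
    rcases hS.apply_coroot μ hν with h | h | h | ⟨rfl, h⟩ | ⟨rfl, h⟩
    · convert hP
      ext x
      simp [coe_reflectRoot, h]
    · exact hsub μ ν _ hμ hν hρ h (by rw [coe_reflectRoot, h, one_smul]) hP
    · refine hsub μ (-ν) _ hμ (by simpa using hν) hρ (by simp [h]) ?_ hP
      rw [coe_reflectRoot, h, Weight.coe_neg, neg_one_smul]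
    · convert hneg μ hμ hP
      ext x
      simp only [coe_reflectRoot, h, Weight.coe_neg, Pi.sub_apply, Pi.smul_apply,
        Pi.neg_apply, smul_eq_mul]
      ring
    · convert hneg _ hμ hP
      ext x
      simp only [coe_reflectRoot, h, Weight.coe_neg, Pi.sub_apply, Pi.smul_apply,
        Pi.neg_apply, smul_eq_mul, neg_neg]
      ring
  let R := IsKilling.rootSystem H
  -- By irreducibility: if a root `j` is not orthogonal to a root `i` with `P`, then `j` is a
  -- multiple of `i - s_j(i)`, and `s_j(i)` also has `P`.
  have hspan : Submodule.span K (R.root '' {i | P i}) = ⊤ := by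
    refine R.span_root_image_eq_top_of_forall_orthogonal _
      ⟨⟨α, mem_root_iff.2 hα⟩, h0⟩ fun j hj i hi => ?_
    by_contra hij
    apply hj
    have hj' := mem_root_iff.1 j.2
    have hi' := mem_root_iff.1 i.2
    have hc : (i : Weight K H 𝔤) (IsKilling.coroot (j : Weight K H 𝔤)) ≠ 0 := by
      intro h
      apply hij
      have h1 : R.pairing i j = 0 := h
      exact ⟨R.pairing_eq_zero_iff'.1 h1, h1⟩
    have h1 : R.root i ∈ Submodule.span K (R.root '' {i | P i}) :=
      Submodule.subset_span ⟨i, hi, rfl⟩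
    have h2 : R.root ⟨IsKilling.reflectRoot (j : Weight K H 𝔤) i,
        mem_root_iff.2 (IsKilling.reflectRoot_isNonZero _ _ hi')⟩ ∈
          Submodule.span K (R.root '' {i | P i}) :=
      Submodule.subset_span ⟨_, hrefl _ _ hi' hj' hi, rfl⟩
    have h3 : R.root j = ((i : Weight K H 𝔤) (IsKilling.coroot (j : Weight K H 𝔤)))⁻¹ •
        (R.root i - R.root ⟨IsKilling.reflectRoot (j : Weight K H 𝔤) i,
        mem_root_iff.2 (IsKilling.reflectRoot_isNonZero _ _ hi')⟩) := by
      ext x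
      simp only [R, IsKilling.rootSystem_root_apply, LinearMap.smul_apply, LinearMap.sub_apply,
        Weight.toLinear_apply, coe_reflectRoot, Pi.sub_apply, Pi.smul_apply, smul_eq_mul]
      field_simp
      ring
    rw [h3]
    exact Submodule.smul_mem _ _ (Submodule.sub_mem _ h1 h2)
  obtain ⟨β, hβ, hP, hc⟩ : ∃ β : Weight K H 𝔤, β.IsNonZero ∧ P β ∧
      β (IsKilling.coroot μ) ≠ 0 := by
    by_contra! hcon
    have hle : Submodule.span K (R.root '' {i | P i}) ≤
        LinearMap.ker (R.coroot' ⟨μ, mem_root_iff.2 hμ⟩) := by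
      rw [Submodule.span_le]
      rintro _ ⟨i, hi, rfl⟩
      exact hcon i (mem_root_iff.1 i.2) hi
    rw [hspan] at hle
    have h1 : R.root ⟨μ, mem_root_iff.2 hμ⟩ ∈
      LinearMap.ker (R.coroot' ⟨μ, mem_root_iff.2 hμ⟩) := hle trivial
    have h2 : μ (IsKilling.coroot μ) = 0 := h1
    rw [IsKilling.root_apply_coroot hμ] at h2
    exact two_ne_zero h2
  by_cases h1 : β = μ
  · exact h1 ▸ hP
  by_cases h2 : β = -μ
  · have := hneg β hβ hP
    rwa [h2, neg_neg] at this
  -- For Cartan integers `±1` one has `s_β s_μ β = ∓μ`, so two reflections, and a sign change if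
  -- needed, lead from `β` to `μ`.
  have hA := hrefl β μ hβ hμ hP
  have hB := hrefl _ β (IsKilling.reflectRoot_isNonZero _ _ hβ) hβ hA
  have h22 := IsKilling.root_apply_coroot hβ
  rcases hS β μ hβ hμ h1 h2 with h | h | h
  · exact absurd h hc
  · have h' := hS.apply_coroot_symm hβ hμ h (Or.inl rfl) h1 h2
    convert hneg _ (IsKilling.reflectRoot_isNonZero _ _
      (IsKilling.reflectRoot_isNonZero _ _ hβ)) hB
    ext x
    simp only [coe_reflectRoot, Weight.coe_neg, Pi.sub_apply, Pi.smul_apply,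
        Pi.neg_apply, smul_eq_mul, h, h', h22]
    ring
  · have h' := hS.apply_coroot_symm hβ hμ h (Or.inr rfl) h1 h2
    convert hB
    ext x
    simp only [coe_reflectRoot, Pi.sub_apply, Pi.smul_apply, smul_eq_mul, h, h', h22]
    ring

end RootInduction

/-! ### `sl₂`-relations on weight vectors. -/

section Extension

variable {K 𝔤 : Type*} [Field K] [CharZero K] [LieRing 𝔤] [LieAlgebra K 𝔤]
  [FiniteDimensional K 𝔤] [LieAlgebra.IsSimple K 𝔤]
  {H : LieSubalgebra K 𝔤} [H.IsCartanSubalgebra] [IsTriangularizable K H 𝔤]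
  {M : Type*} [AddCommGroup M] [Module K M] [LieRingModule 𝔤 M] [LieModule K 𝔤 M]

/-- Root vectors `e α` such that `[e α, e (-α)]` is the coroot of `α`. -/
structure IsRootVectorFamily (e : Weight K H 𝔤 → 𝔤) : Prop where
  mem : ∀ ν : Weight K H 𝔤, ν.IsNonZero → e ν ∈ weightSubspace H 𝔤 (ν : H → K)
  lie_neg : ∀ ν : Weight K H 𝔤, ν.IsNonZero → ⁅e ν, e (-ν)⁆ = ((IsKilling.coroot ν : H) : 𝔤)

variable {e : Weight K H 𝔤 → 𝔤}

theorem IsRootVectorFamily.ne_zero (he : IsRootVectorFamily e) {ν : Weight K H 𝔤}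
    (hν : ν.IsNonZero) : e ν ≠ 0 := by
  intro h
  have h1 := he.lie_neg ν hν
  rw [h, zero_lie, eq_comm, ZeroMemClass.coe_eq_zero, IsKilling.coroot_eq_zero_iff] at h1
  exact hν h1

theorem IsRootVectorFamily.exists_eq_smul (he : IsRootVectorFamily e) {ν : Weight K H 𝔤}
    (hν : ν.IsNonZero) {x : 𝔤} (hx : x ∈ weightSubspace H 𝔤 (ν : H → K)) :
    ∃ c : K, x = c • e ν := by
  have h1 := IsKilling.finrank_rootSpace_eq_one ν hν
  have he' := mem_weightSubspace_adjoint.1 (he.mem ν hν)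
  obtain ⟨c, hc⟩ := (finrank_eq_one_iff_of_nonzero' (⟨e ν, he'⟩ : rootSpace H ν)
    (fun h => he.ne_zero hν (congrArg Subtype.val h))).1 h1
      ⟨x, mem_weightSubspace_adjoint.1 hx⟩
  exact ⟨c, (congrArg Subtype.val hc).symm⟩

theorem IsRootVectorFamily.lie_lie_of_lie_eq_zero (he : IsRootVectorFamily e)
    {ν : Weight K H 𝔤} (hν : ν.IsNonZero) {χ : H → K} {m : M}
    (hm : m ∈ weightSubspace H M χ) (h0 : ⁅e ν, m⁆ = 0) :
    ⁅e ν, ⁅e (-ν), m⁆⁆ = χ (IsKilling.coroot ν) • m := by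
  rw [leibniz_lie, h0, lie_zero, add_zero, he.lie_neg ν hν, mem_weightSubspace.1 hm]

theorem IsRootVectorFamily.lie_lie_lie_of_lie_eq_zero (he : IsRootVectorFamily e)
    {ν : Weight K H 𝔤} (hν : ν.IsNonZero) {m : M}
    (hm : m ∈ weightSubspace H M (ν : H → K)) (h0 : ⁅e ν, m⁆ = 0) :
    ⁅e ν, ⁅e (-ν), ⁅e (-ν), m⁆⁆⁆ = (2 : K) • ⁅e (-ν), m⁆ := by
  have h1 : ⁅e (-ν), m⁆ ∈ weightSubspace H M (0 : H → K) :=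
    lie_mem_weightSubspace (by simp) (he.mem (-ν) (by simpa using hν)) hm
  rw [leibniz_lie, he.lie_neg ν hν, mem_weightSubspace.1 h1,
    he.lie_lie_of_lie_eq_zero hν hm h0, lie_smul, IsKilling.root_apply_coroot hν]
  simp

/-- A root vector annihilates the weight vectors whose weight is nonnegative on the coroot. -/
theorem IsWeightGraded.lie_eq_zero (hS : HasSimplyLacedRoots H) (hM : IsWeightGraded H M)
    {ν : Weight K H 𝔤} (hν : ν.IsNonZero) {χ : H → K} (hχ : χ ≠ 0) {n : ℕ}
    (hn : χ (IsKilling.coroot ν) = n) {y : 𝔤} (hy : y ∈ weightSubspace H 𝔤 (ν : H → K)) {m : M}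
    (hm : m ∈ weightSubspace H M χ) : ⁅y, m⁆ = 0 := by
  refine hM.eq_zero_of_forall_ne (hS.ne_of_apply_coroot hν (n := n) ?_ ?_)
    (lie_mem_weightSubspace (rfl : (ν : H → K) + χ = ν + χ) hy hm)
  · rw [Pi.add_apply, IsKilling.root_apply_coroot hν, hn, add_comm]
  · simpa using hχ

end Extension

/-! ### Products of two modules, in which graphs of homomorphisms live. -/

section ProductModule

variable {K 𝔤 M N : Type*} [CommRing K] [LieRing 𝔤] [LieAlgebra K 𝔤]
  [AddCommGroup M] [Module K M] [LieRingModule 𝔤 M] [LieModule K 𝔤 M]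
  [AddCommGroup N] [Module K N] [LieRingModule 𝔤 N] [LieModule K 𝔤 N]

instance prodLieRingModule : LieRingModule 𝔤 (M × N) where
  bracket y m := (⁅y, m.1⁆, ⁅y, m.2⁆)
  add_lie := fun y z m => by ext <;> exact add_lie ..
  lie_add := fun y m n => by ext <;> exact lie_add ..
  leibniz_lie := fun y z m => by ext <;> exact leibniz_lie ..

theorem lie_prod (y : 𝔤) (m : M × N) : ⁅y, m⁆ = (⁅y, m.1⁆, ⁅y, m.2⁆) := rfl

instance prodLieModule : LieModule K 𝔤 (M × N) where
  smul_lie := fun c y m => by ext <;> exact smul_lie ..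
  lie_smul := fun c y m => by ext <;> exact lie_smul ..

variable (K 𝔤 M N) in
/-- The first projection of a product of modules. -/
def fstLieModuleHom : M × N →ₗ⁅K,𝔤⁆ M where
  toLinearMap := LinearMap.fst K M N
  map_lie' := rfl

variable (K 𝔤 M N) in
/-- The second projection of a product of modules. -/
def sndLieModuleHom : M × N →ₗ⁅K,𝔤⁆ N where
  toLinearMap := LinearMap.snd K M N
  map_lie' := rfl

end ProductModule

/-! ### Homomorphisms from the adjoint module with prescribed value at a root vector. -/

section Extension

variable {K 𝔤 : Type*} [Field K] [CharZero K] [LieRing 𝔤] [LieAlgebra K 𝔤]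
  [FiniteDimensional K 𝔤] [LieAlgebra.IsSimple K 𝔤]
  {H : LieSubalgebra K 𝔤} [H.IsCartanSubalgebra] [IsTriangularizable K H 𝔤]
  {M : Type*} [AddCommGroup M] [Module K M] [LieRingModule 𝔤 M] [LieModule K 𝔤 M]
  {e : Weight K H 𝔤 → 𝔤}

theorem mem_weightSubspace_prod {N : Type*} [AddCommGroup N] [Module K N] [LieRingModule 𝔤 N]
    [LieModule K 𝔤 N] {χ : H → K} {m : M × N} :
    m ∈ weightSubspace H (M × N) χ ↔
      m.1 ∈ weightSubspace H M χ ∧ m.2 ∈ weightSubspace H N χ := by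
  simp only [mem_weightSubspace, lie_prod, Prod.ext_iff, Prod.smul_fst, Prod.smul_snd,
    forall_and]

theorem IsWeightGraded.prod {N : Type*} [AddCommGroup N] [Module K N] [LieRingModule 𝔤 N]
    [LieModule K 𝔤 N] (hM : IsWeightGraded H M) (hN : IsWeightGraded H N) :
    IsWeightGraded H (M × N) := by
  have h1 : (⊤ : Submodule K M) ≤ (⨆ ν : Weight K H 𝔤,
      weightSubspace H (M × N) (ν : H → K)).comap (LinearMap.inl K M N) := by
    rw [← hM]
    refine iSup_le fun ν m hm => Submodule.mem_iSup_of_mem ν ?_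
    exact mem_weightSubspace_prod.2 ⟨hm, Submodule.zero_mem _⟩
  have h2 : (⊤ : Submodule K N) ≤ (⨆ ν : Weight K H 𝔤,
      weightSubspace H (M × N) (ν : H → K)).comap (LinearMap.inr K M N) := by
    rw [← hN]
    refine iSup_le fun ν m hm => Submodule.mem_iSup_of_mem ν ?_
    exact mem_weightSubspace_prod.2 ⟨Submodule.zero_mem _, hm⟩
  rw [IsWeightGraded, eq_top_iff]
  rintro ⟨m, n⟩ -
  have : (m, n) = LinearMap.inl K M N m + LinearMap.inr K M N n := by simp
  rw [this]
  exact Submodule.add_mem _ (h1 trivial) (h2 trivial)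

theorem lieIdeal_eq_top_of_mem {I : LieIdeal K 𝔤} {x : 𝔤} (hx : x ∈ I) (h0 : x ≠ 0) : I = ⊤ := by
  refine (LieAlgebra.IsSimple.eq_bot_or_eq_top I).resolve_left ?_
  rintro rfl
  exact h0 ((LieSubmodule.mem_bot x).1 hx)

/-- A weight vector whose weight is a root is the image of the corresponding root vector under
a homomorphism from the adjoint module. -/
theorem IsRootVectorFamily.exists_hom (hS : HasSimplyLacedRoots H) (he : IsRootVectorFamily e)
    (hM : IsWeightGraded H M) {α : Weight K H 𝔤} (hα : α.IsNonZero) {x : M}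
    (hx : x ∈ weightSubspace H M (α : H → K)) : ∃ φ : 𝔤 →ₗ⁅K,𝔤⁆ M, φ (e α) = x := by
  have hG := (isWeightGraded_adjoint H).prod hM
  -- The submodule generated by `(e α, x)` is to become the graph of `φ`.
  set w : 𝔤 × M := (e α, x) with hw
  have hwα : w ∈ weightSubspace H (𝔤 × M) (α : H → K) :=
    mem_weightSubspace_prod.2 ⟨he.mem α hα, hx⟩
  set T := LieSubmodule.lieSpan K 𝔤 {w} with hT
  have hwT : w ∈ T := LieSubmodule.subset_lieSpan rfl
  let π : T →ₗ⁅K,𝔤⁆ 𝔤 := (fstLieModuleHom K 𝔤 𝔤 M).comp T.incl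
  have hπ : Function.Surjective π := by
    rw [← LieModuleHom.range_eq_top]
    exact lieIdeal_eq_top_of_mem ((LieModuleHom.mem_range π _).2 ⟨⟨w, hwT⟩, rfl⟩) (he.ne_zero hα)
  -- The kernel of the projection to `𝔤` has no nonzero weight. For `α` itself this holds because
  -- the `α`-weight space of `T` is spanned by `w`, whose first entry is nonzero.
  have hext : ∀ {ν : Weight K H 𝔤}, ν.IsNonZero → ∀ m ∈ T, m.1 = 0 →
      m ∈ weightSubspace H (𝔤 × M) (ν : H → K) → m = 0 := by
    intro ν hν
    refine hS.root_induction (P := fun ν => ∀ m ∈ T, m.1 = 0 →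
      m ∈ weightSubspace H (𝔤 × M) (ν : H → K) → m = 0) hα ?_ ?_ ?_ hν
    · intro m hmT hm1 hm
      have h1 := hG.lieSpan_le_span_sup hS hα hwα hmT
      obtain ⟨_, hcw, s, hs, rfl⟩ := Submodule.mem_sup.1 h1
      obtain ⟨c, rfl⟩ := Submodule.mem_span_singleton.1 hcw
      have hsα : s ∈ weightSubspace H (𝔤 × M) (α : H → K) := by
        have := Submodule.sub_mem _ hm (Submodule.smul_mem _ c hwα)
        rwa [add_sub_cancel_left] at this
      have hs0 : s = 0 := Submodule.disjoint_def.1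
        (iSupIndep_weightSubspace_weight H (𝔤 × M) α) s hsα hs
      rw [hs0, add_zero] at hm1 ⊢
      have hc : c = 0 := (smul_eq_zero.1 hm1).resolve_right (he.ne_zero hα)
      rw [hc, zero_smul]
    -- `e (-ν)` kills `m`, and `(e ν)² m` has weight `ν`, so it vanishes by induction. Applying `e
    -- (-ν)` recovers first `2 • ⁅e ν, m⁆` and then `2 • m`, so both are `0`.
    · intro ν hν ih m hmT hm1 hm
      have hν' : (-ν).IsNonZero := by simpa using hν
      have hval := IsKilling.root_apply_coroot hν'
      have h0 : ⁅e (-ν), m⁆ = 0 := hG.lie_eq_zero hS hν'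
        (fun h => hν' h) (n := 2) (by rw [hval]; norm_num) (he.mem _ hν') hm
      have h2 : ⁅e ν, ⁅e ν, m⁆⁆ = 0 := by
        refine ih _ (T.lie_mem (T.lie_mem hmT)) (by simp [lie_prod, hm1]) ?_
        have h3 : ⁅e ν, m⁆ ∈ weightSubspace H (𝔤 × M) (0 : H → K) :=
          lie_mem_weightSubspace (by simp) (he.mem ν hν) hm
        exact lie_mem_weightSubspace (by simp) (he.mem ν hν) h3
      have h3 := he.lie_lie_lie_of_lie_eq_zero hν' hm h0
      have h4 := he.lie_lie_of_lie_eq_zero hν' hm h0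
      rw [neg_neg] at h3 h4
      rw [h2, lie_zero, eq_comm, smul_eq_zero] at h3
      rw [h3.resolve_left two_ne_zero, lie_zero, hval, eq_comm, smul_eq_zero] at h4
      exact h4.resolve_left two_ne_zero
    -- `e (-ν)` kills `m`, and `⁅e ν, m⁆` has weight `μ`, so it vanishes by induction; applying `e
    -- (-ν)` to it gives back `m`.
    · intro μ ν ρ hμ hν hρ hμν hρeq ih m hmT hm1 hm
      have hν' : (-ν).IsNonZero := by simpa using hν
      have hval : ρ (IsKilling.coroot (-ν)) = 1 := by
        rw [IsKilling.coroot_neg, hρeq, Pi.sub_apply]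
        have h1 := IsKilling.root_apply_coroot hν
        have h2 : μ (-IsKilling.coroot ν) = -μ (IsKilling.coroot ν) := map_neg μ.toLinear _
        have h3 : ν (-IsKilling.coroot ν) = -ν (IsKilling.coroot ν) := map_neg ν.toLinear _
        rw [h2, h3, h1, hμν]
        norm_num
      have h0 : ⁅e (-ν), m⁆ = 0 := hG.lie_eq_zero hS hν'
        (fun h => hρ h) (n := 1) (by rw [hval]; norm_num) (he.mem _ hν') hm
      have h2 : ⁅e ν, m⁆ = 0 := by
        refine ih _ (T.lie_mem hmT) (by simp [lie_prod, hm1]) ?_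
        exact lie_mem_weightSubspace (by simp [hρeq]) (he.mem ν hν) hm
      have h4 := he.lie_lie_of_lie_eq_zero hν' hm h0
      rw [neg_neg, h2, lie_zero, hval, one_smul] at h4
      exact h4.symm
  -- `T` is the sum of its weight spaces, so every weight component of a kernel element is again in
  -- the kernel; only weight `0` survives.
  have hzero : ∀ m ∈ T, m.1 = 0 → m ∈ weightSubspace H (𝔤 × M) (0 : H → K) := by
    intro m hmT hm1
    obtain ⟨f, hf, hsum⟩ := (Submodule.mem_iSup_iff_exists_finsupp _ _).1
      (hG.lieSpan_le_iSup hwα hmT)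
    rw [Finsupp.sum] at hsum
    have hf1 : ∀ ν ∈ f.support, (f ν).1 = 0 := by
      refine (iSupIndep_iff_finsetSum_eq_zero_imp_eq_zero _).1
        (iSupIndep_weightSubspace_weight H 𝔤) f.support (fun ν => (f ν).1)
        (fun ν _ => (mem_weightSubspace_prod.1 (hf ν).2).1) ?_
      rw [← Prod.fst_sum, hsum, hm1]
    rw [← hsum]
    refine Submodule.sum_mem _ fun ν hν => ?_
    by_cases hν0 : ν.IsZero
    · rw [← hν0.eq]
      exact (hf ν).2
    · rw [hext hν0 _ (hf ν).1 (hf1 ν hν) (hf ν).2]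
      exact Submodule.zero_mem _
  have hinj : Function.Injective π := by
    refine injective_of_trivial_kernel π hπ ?_ ?_
    · intro m hm y
      have hm0 := hzero m m.2 hm
      refine Subtype.ext ?_
      change ⁅y, (m : 𝔤 × M)⁆ = 0
      rw [← Submodule.mem_bot K]
      refine lie_mem_of_forall_weight (H := H) (fun μ y hy => ?_) y
      rw [Submodule.mem_bot]
      by_cases hμ : μ.IsZero
      · rw [hμ.eq] at hy
        have := (mem_weightSubspace.1 hm0) ⟨y, mem_of_mem_weightSubspace_zero hy⟩
        simpa using this
      · refine hext hμ _ (T.lie_mem m.2) ?_ (lie_mem_weightSubspace (by simp) hy hm0)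
        have h1 : (m : 𝔤 × M).1 = 0 := hm
        rw [lie_prod, h1, lie_zero]
    · intro l hl
      -- `T` is perfect: the generator satisfies `α^∨ w = 2w`, so `l` kills it. The kernel of `l`
      -- contains all brackets, hence is a submodule, hence is `T`.
      let D : LieSubmodule K 𝔤 (𝔤 × M) :=
        { Submodule.map T.toSubmodule.subtype (LinearMap.ker l) with
          lie_mem := by
            rintro y _ ⟨m, -, rfl⟩
            exact ⟨(⁅y, (show T from m)⁆ : T), hl y m, rfl⟩ }
      have hTD : T ≤ D := by
        rw [hT, LieSubmodule.lieSpan_le, Set.singleton_subset_iff]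
        refine ⟨⟨w, hwT⟩, ?_, rfl⟩
        have h1 : ⁅((IsKilling.coroot α : H) : 𝔤), (⟨w, hwT⟩ : T)⁆ = (2 : K) • ⟨w, hwT⟩ := by
          refine Subtype.ext ?_
          rw [← IsKilling.root_apply_coroot hα]
          exact mem_weightSubspace.1 hwα _
        have h2 := hl ((IsKilling.coroot α : H) : 𝔤) ⟨w, hwT⟩
        rw [h1, map_smul, smul_eq_zero] at h2
        exact h2.resolve_left two_ne_zero
      ext m
      obtain ⟨m', hm', hmm⟩ := hTD m.2
      rw [← Subtype.ext hmm]
      exact hm'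
  let E := LinearEquiv.ofBijective (π : T →ₗ[K] 𝔤) ⟨hinj, hπ⟩
  have hE : ∀ t : T, E.symm (π t) = t := fun t => E.symm_apply_apply t
  let φ : 𝔤 →ₗ⁅K,𝔤⁆ M :=
    { (sndLieModuleHom K 𝔤 𝔤 M : 𝔤 × M →ₗ[K] M) ∘ₗ T.toSubmodule.subtype ∘ₗ E.symm.toLinearMap with
      map_lie' := by
        intro y z
        obtain ⟨t, rfl⟩ := hπ z
        change (E.symm ⁅y, π t⁆ : 𝔤 × M).2 = ⁅y, (E.symm (π t) : 𝔤 × M).2⁆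
        rw [← LieModuleHom.map_lie, hE, hE]
        rfl }
  refine ⟨φ, ?_⟩
  change (E.symm (π ⟨w, hwT⟩) : 𝔤 × M).2 = x
  rw [hE]

/-- A homomorphism from the adjoint module is determined by its value on a root vector. -/
theorem IsRootVectorFamily.hom_ext (he : IsRootVectorFamily e) {α : Weight K H 𝔤}
    (hα : α.IsNonZero) {φ ψ : 𝔤 →ₗ⁅K,𝔤⁆ M} (h : φ (e α) = ψ (e α)) : φ = ψ := by
  have hk : (φ - ψ).ker = ⊤ :=
    lieIdeal_eq_top_of_mem (x := e α) (by simp [LieModuleHom.mem_ker, h]) (he.ne_zero hα)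
  ext y
  have : y ∈ (φ - ψ).ker := hk ▸ LieSubmodule.mem_top y
  rw [LieModuleHom.mem_ker] at this
  exact sub_eq_zero.1 this

end Extension

/-! ### Weyl group representatives and the transfer maps. -/

section Transfer

variable {K L : Type*} [Field K] [CharZero K] [LieRing L] [LieAlgebra K L]
  {g : LieSubalgebra K L} [FiniteDimensional K g] [LieAlgebra.IsSimple K g]
  {H : LieSubalgebra K g} [H.IsCartanSubalgebra] [IsTriangularizable K H g]
  {e : Weight K H g → g}

theorem component_eq_weightSubspace (χ : H → K) : component H χ = weightSubspace H L χ := by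
  ext x
  rw [mem_weightSubspace]
  rfl

theorem mem_component_iff_mem_weightSubspace {χ : H → K} {x : L} :
    x ∈ component H χ ↔ x ∈ weightSubspace H L χ := by
  rw [component_eq_weightSubspace]

theorem coe_mem_component {χ : H → K} {x : g} :
    (x : L) ∈ component H χ ↔ x ∈ weightSubspace H g χ := by
  rw [mem_weightSubspace]
  exact forall_congr' fun h => (Subtype.ext_iff (a1 := ⁅(h : g), x⁆) (a2 := χ h • x)).symm

theorem IsRootGraded.isWeightGraded (hL : IsRootGraded (K := K) (L := L) H) :
    IsWeightGraded H L := by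
  rw [IsWeightGraded, ← hL.iSup_eq_top]
  simp_rw [component_eq_weightSubspace]

theorem IsSimplyLaced.hasSimplyLacedRoots (h : IsSimplyLaced H) : HasSimplyLacedRoots H :=
  fun μ ν hμ hν h1 h2 => h ⟨μ, mem_root_iff.2 hμ⟩ ⟨ν, mem_root_iff.2 hν⟩ h1 h2

theorem IsChevalleyBasis.isRootVectorFamily (he : IsChevalleyBasis e) : IsRootVectorFamily e where
  mem ν hν := mem_weightSubspace_adjoint.2 (he.mem_rootSpace ν (mem_root_iff.2 hν))
  lie_neg ν hν := he.lie_neg ν (mem_root_iff.2 hν)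

/-! ### Exponentials of nilpotent endomorphisms -/

theorem expNilpotent_eq_of_pow_three {V : Type*} [LieRing V] [LieAlgebra K V]
    {f : Module.End K V} (hf : f ^ 3 = 0) : expNilpotent f = 1 + f + (2 : K)⁻¹ • f ^ 2 := by
  have hle : nilpotencyClass f ≤ 3 := Nat.sInf_le hf
  have hzero : f ^ nilpotencyClass f = 0 := pow_nilpotencyClass ⟨3, hf⟩
  have h1 : expNilpotent f = ∑ n ∈ Finset.range 3, ((n.factorial : K)⁻¹) • f ^ n := by
    rw [expNilpotent]
    refine Finset.sum_subset (Finset.range_mono hle) fun n _ hn => ?_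
    rw [Finset.mem_range, not_lt] at hn
    rw [pow_eq_zero_of_le hn hzero, smul_zero]
  rw [h1]
  simp [Finset.sum_range_succ, Nat.factorial]

theorem expNilpotent_mul_expNilpotent_neg {V : Type*} [LieRing V] [LieAlgebra K V]
    {f : Module.End K V} (hf : f ^ 3 = 0) : expNilpotent f * expNilpotent (-f) = 1 := by
  rw [expNilpotent_eq_of_pow_three hf,
    expNilpotent_eq_of_pow_three (f := -f) (by rw [Odd.neg_pow (by decide), hf, neg_zero])]
  have h4 : f ^ 4 = 0 := by rw [pow_succ, hf, zero_mul]
  have h3 : f * f ^ 2 = 0 := by rw [← pow_succ', hf]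
  have h3' : f ^ 2 * f = 0 := by rw [← pow_succ, hf]
  have h22 : f ^ 2 * f ^ 2 = 0 := by rw [← pow_add, h4]
  simp only [add_mul, mul_add, one_mul, mul_one, neg_sq, smul_mul_assoc, mul_smul_comm, mul_neg,
    h3, h3', h22, ← sq, smul_zero, add_zero]
  have h2 : (2 : K)⁻¹ + 2⁻¹ = 1 := by norm_num
  have h5 : (2 : K)⁻¹ • f ^ 2 + (2 : K)⁻¹ • f ^ 2 = f ^ 2 := by rw [← add_smul, h2, one_smul]
  calc _ = 1 + (((2 : K)⁻¹ • f ^ 2 + (2 : K)⁻¹ • f ^ 2) - f ^ 2) := by abel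
    _ = 1 := by rw [h5, sub_self, add_zero]

theorem isUnit_expNilpotent {V : Type*} [LieRing V] [LieAlgebra K V]
    {f : Module.End K V} (hf : f ^ 3 = 0) : IsUnit (expNilpotent f) := by
  have hf' : (-f) ^ 3 = 0 := by rw [Odd.neg_pow (by decide), hf, neg_zero]
  have h := expNilpotent_mul_expNilpotent_neg hf'
  rw [neg_neg] at h
  exact ⟨⟨_, _, expNilpotent_mul_expNilpotent_neg hf, h⟩, rfl⟩

/-! ### The action of the group `adN` -/

theorem coe_lie_eq (y : g) (x : L) : ⁅y, x⁆ = ⁅(y : L), x⁆ := rfl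

/-- For a weight `χ`, the functional `χ + 3ν` has value at least `4` on the coroot of `ν`, so it is
not a weight. Exponentials therefore reduce to quadratic polynomials. -/
theorem IsRootVectorFamily.ad_pow_three (hS : HasSimplyLacedRoots H) (he : IsRootVectorFamily e)
    (hL : IsWeightGraded H L) {ν : Weight K H g} (hν : ν.IsNonZero) (c : K) :
    (LieAlgebra.ad K L (c • (e ν : L))) ^ 3 = 0 := by
  have h3 : ∀ x : L, ⁅e ν, ⁅e ν, ⁅e ν, x⁆⁆⁆ = 0 := by
    intro x
    have hx : x ∈ ⨆ χ : Weight K H g, weightSubspace H L (χ : H → K) := by rw [hL]; trivial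
    induction hx using Submodule.iSup_induction' with
    | mem χ x hx =>
      have h1 := lie_mem_weightSubspace rfl (he.mem ν hν) (lie_mem_weightSubspace rfl
        (he.mem ν hν) (lie_mem_weightSubspace rfl (he.mem ν hν) hx))
      have h2 := IsKilling.root_apply_coroot hν
      -- The bound `2 ≤ n` separates `χ + 3ν` from `ν`, whose value on the coroot is `2`.
      obtain ⟨n, hn, hn2⟩ : ∃ n : ℕ, χ (IsKilling.coroot ν) + 6 = n + 2 ∧ 2 ≤ n := by
        rcases hS.apply_coroot χ hν with h | h | h | ⟨-, h⟩ | ⟨-, h⟩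
        exacts [⟨4, by rw [h]; norm_num, by norm_num⟩, ⟨5, by rw [h]; norm_num, by norm_num⟩,
          ⟨3, by rw [h]; norm_num, by norm_num⟩, ⟨6, by rw [h]; norm_num, by norm_num⟩,
          ⟨2, by rw [h]; norm_num, by norm_num⟩]
      have hval : ((ν : H → K) + (ν + (ν + χ))) (IsKilling.coroot ν) = n + 2 := by
        simp only [Pi.add_apply, h2]
        linear_combination hn
      refine hL.eq_zero_of_forall_ne (hS.ne_of_apply_coroot hν (n := n) hval ?_) h1
      intro h
      rw [h, h2] at hval
      have : (n : K) = 0 := by linear_combination -hval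
      norm_cast at this
      omega
    | zero => simp
    | add x y _ _ hx hy => simp only [lie_add, hx, hy, add_zero]
  ext x
  have := h3 x
  simp only [coe_lie_eq] at this
  simp [pow_succ, this]

theorem IsRootVectorFamily.isUnit_adEta (hS : HasSimplyLacedRoots H) (he : IsRootVectorFamily e)
    (hL : IsWeightGraded H L) {ν : Weight K H g} (hν : ν.IsNonZero) (t : K) :
    IsUnit (adEta e ν t) :=
  ((isUnit_expNilpotent (he.ad_pow_three hS hL hν t)).mul
    (isUnit_expNilpotent (he.ad_pow_three hS hL (by simpa using hν) _))).mul
      (isUnit_expNilpotent (he.ad_pow_three hS hL hν t))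

theorem adEta_one_apply (ν : Weight K H g) (x : L) : adEta e ν 1 x =
      expNilpotent (LieAlgebra.ad K L (e ν : L))
        (expNilpotent (-LieAlgebra.ad K L (e (-ν) : L))
          (expNilpotent (LieAlgebra.ad K L (e ν : L)) x)) := by
  simp [adEta, Module.End.mul_apply]

/-- The reflection in `ν` sends weight vectors with `⟨χ, ν^∨⟩ = 1` to weight `χ - ν`. -/
theorem IsRootVectorFamily.adEta_one_apply_of_apply_coroot_eq_one (hS : HasSimplyLacedRoots H)
    (he : IsRootVectorFamily e) (hL : IsWeightGraded H L) {χ ν : Weight K H g}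
    (hν : ν.IsNonZero) (hχ : χ (IsKilling.coroot ν) = 1) {x : L}
    (hx : x ∈ weightSubspace H L (χ : H → K)) : adEta e ν 1 x = -⁅e (-ν), x⁆ := by
  have hν' : (-ν).IsNonZero := by simpa using hν
  have hχ0 : (χ : H → K) ≠ 0 := by
    intro h
    have : χ (IsKilling.coroot ν) = 0 := congrFun h _
    rw [this] at hχ
    exact zero_ne_one hχ
  have h0 : ⁅e ν, x⁆ = 0 :=
    hL.lie_eq_zero hS hν hχ0 (n := 1) (by rw [hχ]; norm_num) (he.mem ν hν) hx
  have h1 : ⁅e ν, ⁅e (-ν), x⁆⁆ = x := by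
    rw [he.lie_lie_of_lie_eq_zero hν hx h0, hχ, one_smul]
  have h2 : ⁅e (-ν), ⁅e (-ν), x⁆⁆ = 0 := by
    have hval : ((-ν : Weight K H g) + χ : H → K) (IsKilling.coroot (-ν)) = 1 := by
      have h3 : χ (-IsKilling.coroot ν) = -χ (IsKilling.coroot ν) := map_neg χ.toLinear _
      rw [Pi.add_apply, IsKilling.root_apply_coroot hν', IsKilling.coroot_neg, h3, hχ]
      norm_num
    refine hL.lie_eq_zero hS hν' (χ := (-ν : Weight K H g) + χ) (n := 1) ?_ ?_ (he.mem _ hν')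
      (lie_mem_weightSubspace rfl (he.mem _ hν') hx)
    · intro h
      rw [h] at hval
      exact zero_ne_one hval
    · rw [hval]; norm_num
  have hp := he.ad_pow_three hS hL hν 1
  have hm := he.ad_pow_three hS hL hν' (-1)
  rw [one_smul] at hp
  rw [neg_one_smul, map_neg] at hm
  rw [adEta_one_apply, expNilpotent_eq_of_pow_three hp,
    expNilpotent_eq_of_pow_three hm]
  simp only [coe_lie_eq] at h0 h1 h2 ⊢
  simp [pow_succ, h0, h1, h2, -lie_skew]

/-- The reflection in `ν` sends weight vectors of weight `ν` to weight `-ν`. -/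
theorem IsRootVectorFamily.adEta_one_apply_self (hS : HasSimplyLacedRoots H)
    (he : IsRootVectorFamily e) (hL : IsWeightGraded H L) {ν : Weight K H g}
    (hν : ν.IsNonZero) {x : L} (hx : x ∈ weightSubspace H L (ν : H → K)) :
    adEta e ν 1 x = (2 : K)⁻¹ • ⁅e (-ν), ⁅e (-ν), x⁆⁆ := by
  have hν' : (-ν).IsNonZero := by simpa using hν
  have hval := IsKilling.root_apply_coroot hν
  have h0 : ⁅e ν, x⁆ = 0 :=
    hL.lie_eq_zero hS hν (fun h => hν h) (n := 2) (by rw [hval]; norm_num) (he.mem ν hν) hx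
  have h1 : ⁅e ν, ⁅e (-ν), x⁆⁆ = (2 : K) • x := by
    rw [he.lie_lie_of_lie_eq_zero hν hx h0, hval]
  have h2 : ⁅e ν, ⁅e (-ν), ⁅e (-ν), x⁆⁆⁆ = (2 : K) • ⁅e (-ν), x⁆ :=
    he.lie_lie_lie_of_lie_eq_zero hν hx h0
  have hp := he.ad_pow_three hS hL hν 1
  have hm := he.ad_pow_three hS hL hν' (-1)
  rw [one_smul] at hp
  rw [neg_one_smul, map_neg] at hm
  rw [adEta_one_apply, expNilpotent_eq_of_pow_three hp,
    expNilpotent_eq_of_pow_three hm]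
  simp only [coe_lie_eq] at h0 h1 h2 ⊢
  simp [pow_succ, h0, h1, h2, smul_smul, -lie_skew]
  module

/-- The property of the pairs `(u, ε)` in the definition of the transfer map. -/
def IsTransfer (e : Weight K H g → g) (β α : Weight K H g) (p : (L ≃ₗ[K] L) × K) : Prop :=
  p.1 ∈ adN e ∧ p.2 ≠ 0 ∧ p.1 (e α : L) = p.2 • (e β : L) ∧
    ∀ x ∈ component H (α : H → K), (p.1 : L →ₗ[K] L) x ∈ component H (β : H → K)

/-- `hg` is needed because root spaces are one-dimensional only inside `g`; it makes the image of `e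
μ` a multiple of `e ρ`. -/
theorem IsRootVectorFamily.exists_isTransfer_succ (hS : HasSimplyLacedRoots H)
    (he : IsRootVectorFamily e) (hL : IsWeightGraded H L) {α μ ν ρ : Weight K H g}
    (hμ : μ.IsNonZero) (hν : ν.IsNonZero) (hρ : ρ.IsNonZero)
    (hmaps : ∀ x ∈ component (L := L) H (μ : H → K), adEta e ν 1 x ∈ component H (ρ : H → K))
    (hg : adEta e ν 1 (e μ : L) ∈ g)
    (h : ∃ p, IsTransfer (L := L) e μ α p) : ∃ p, IsTransfer (L := L) e ρ α p := by
  obtain ⟨⟨u, c⟩, hu, hc, huc, hmap⟩ := h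
  have hunit := he.isUnit_adEta hS hL hν 1
  have hbij := (Module.End.isUnit_iff _).1 hunit
  let U : L ≃ₗ[K] L := LinearEquiv.ofBijective (adEta e ν 1) hbij
  have hU : U ∈ adN e := Subgroup.subset_closure ⟨ν, mem_root_iff.2 hν, 1, one_ne_zero, rfl⟩
  obtain ⟨d, hd⟩ := he.exists_eq_smul hρ (x := ⟨_, hg⟩)
    (coe_mem_component.1 (hmaps _ (coe_mem_component.2 (he.mem μ hμ))))
  have hd' : U (e μ : L) = d • (e ρ : L) := congrArg Subtype.val hd
  have hd0 : d ≠ 0 := by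
    rintro rfl
    rw [zero_smul, LinearEquiv.map_eq_zero_iff, ZeroMemClass.coe_eq_zero] at hd'
    exact he.ne_zero hμ hd'
  refine ⟨(U * u, c * d), mul_mem hU hu, mul_ne_zero hc hd0, ?_, fun x hx => ?_⟩
  · simp only at huc
    rw [LinearEquiv.mul_apply, huc, map_smul, hd', smul_smul]
  · exact hmaps _ (hmap x hx)

/-- The group `adN` contains elements that transfer any root space to any other. -/
theorem IsRootVectorFamily.exists_isTransfer (hS : HasSimplyLacedRoots H)
    (he : IsRootVectorFamily e) (hL : IsWeightGraded H L) {α β : Weight K H g}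
    (hα : α.IsNonZero) (hβ : β.IsNonZero) : ∃ p, IsTransfer (L := L) e β α p := by
  refine hS.root_induction (P := fun β => ∃ p, IsTransfer (L := L) e β α p) hα ?_ ?_ ?_ hβ
  · exact ⟨(1, 1), one_mem _, one_ne_zero, (one_smul K _).symm, fun x hx => hx⟩
  · intro ν hν
    have hν' : (-ν).IsNonZero := by simpa using hν
    refine he.exists_isTransfer_succ hS hL hν hν hν' (fun x hx => ?_) ?_
    · rw [mem_component_iff_mem_weightSubspace] at hx ⊢
      rw [he.adEta_one_apply_self hS hL hν hx]
      refine Submodule.smul_mem _ _ (lie_mem_weightSubspace (ψ := 0) (by simp) (he.mem _ hν')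
        (lie_mem_weightSubspace (by simp) (he.mem _ hν') hx))
    · rw [he.adEta_one_apply_self hS hL hν
        (mem_component_iff_mem_weightSubspace.1 (coe_mem_component.2 (he.mem ν hν)))]
      exact g.smul_mem _ (g.lie_mem (e (-ν)).2 (g.lie_mem (e (-ν)).2 (e ν).2))
  · intro μ ν ρ hμ hν hρ hμν hρeq
    have hν' : (-ν).IsNonZero := by simpa using hν
    refine he.exists_isTransfer_succ hS hL hμ hν hρ (fun x hx => ?_) ?_
    · rw [mem_component_iff_mem_weightSubspace] at hx ⊢
      rw [he.adEta_one_apply_of_apply_coroot_eq_one hS hL hν hμν hx]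
      refine Submodule.neg_mem _ (lie_mem_weightSubspace ?_ (he.mem _ hν') hx)
      rw [hρeq, Weight.coe_neg]
      abel
    · rw [he.adEta_one_apply_of_apply_coroot_eq_one hS hL hν hμν
        (mem_component_iff_mem_weightSubspace.1 (coe_mem_component.2 (he.mem μ hμ)))]
      exact g.neg_mem (g.lie_mem (e (-ν)).2 (e μ).2)

/-- One `v` serves all `φ`, because `φ` intertwines the powers of `ad z` on `g` and on `L`. The sum
on `g` is cut off at the nilpotency class on `L` so that terms match one by one. -/
theorem exists_end_expNilpotent (z : g) : ∃ v : Module.End K g, ∀ (φ : g →ₗ⁅K,g⁆ L) (y : g),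
    expNilpotent (LieAlgebra.ad K L (z : L)) (φ y) = φ (v y) := by
  have hpow : ∀ (n : ℕ) (φ : g →ₗ⁅K,g⁆ L) (y : g),
      ((LieAlgebra.ad K L (z : L)) ^ n) (φ y) = φ (((LieAlgebra.ad K g z) ^ n) y) := by
    intro n φ
    induction n with
    | zero => intro y; rfl
    | succ n ih =>
      intro y
      rw [pow_succ, pow_succ, Module.End.mul_apply, Module.End.mul_apply, ← ih]
      congr 1
      exact (φ.map_lie z y).symm
  refine ⟨∑ n ∈ Finset.range (nilpotencyClass (LieAlgebra.ad K L (z : L))),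
    ((n.factorial : K)⁻¹) • (LieAlgebra.ad K g z) ^ n, fun φ y => ?_⟩
  simp only [expNilpotent, LinearMap.sum_apply, LinearMap.smul_apply, hpow, map_sum, map_smul]

/-- The elements of `adN` commute with the homomorphisms from the adjoint module. -/
theorem exists_equiv_of_mem_adN {u : L ≃ₗ[K] L} (hu : u ∈ adN e) :
    ∃ v : g ≃ₗ[K] g, ∀ (φ : g →ₗ⁅K,g⁆ L) (y : g), u (φ y) = φ (v y) := by
  induction hu using Subgroup.closure_induction with
  | mem u hu =>
    obtain ⟨ν, -, t, -, hut⟩ := hu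
    obtain ⟨v₁, h₁⟩ := exists_end_expNilpotent (t • e ν)
    obtain ⟨v₂, h₂⟩ := exists_end_expNilpotent (-t⁻¹ • e (-ν))
    have huv : ∀ (φ : g →ₗ⁅K,g⁆ L) (y : g), u (φ y) = φ (v₁ (v₂ (v₁ y))) := by
      intro φ y
      rw [← h₁, ← h₂, ← h₁]
      exact LinearMap.congr_fun hut (φ y)
    -- Injectivity is inherited from `u` through the inclusion `g → L`; finite dimension then makes
    -- the map bijective.
    have hinj : Function.Injective (v₁ ∘ₗ v₂ ∘ₗ v₁ : Module.End K g) := by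
      intro y z hyz
      have h3 := (huv g.incl' y).trans ((congrArg g.incl' hyz).trans (huv g.incl' z).symm)
      exact Subtype.ext (u.injective h3)
    exact ⟨LinearEquiv.ofInjectiveEndo _ hinj, huv⟩
  | one => exact ⟨1, fun φ y => rfl⟩
  | mul u₁ u₂ _ _ h₁ h₂ =>
    obtain ⟨v₁, h₁⟩ := h₁
    obtain ⟨v₂, h₂⟩ := h₂
    refine ⟨v₁ * v₂, fun φ y => ?_⟩
    rw [LinearEquiv.mul_apply, LinearEquiv.mul_apply, h₂, h₁]
  | inv u _ h =>
    obtain ⟨v, h⟩ := h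
    refine ⟨v⁻¹, fun φ y => u.injective ?_⟩
    rw [h]
    change u (u.symm (φ y)) = φ (v (v.symm y))
    rw [LinearEquiv.apply_symm_apply, LinearEquiv.apply_symm_apply]

/-- The transfer maps send `φ (e α)` to `φ (e β)` for all homomorphisms `φ` from the adjoint
module. -/
theorem IsRootVectorFamily.theta_apply (hS : HasSimplyLacedRoots H)
    (he : IsRootVectorFamily e) (hL : IsWeightGraded H L) {α β : Weight K H g}
    (hα : α.IsNonZero) (hβ : β.IsNonZero) (φ : g →ₗ⁅K,g⁆ L)
    (x : component (L := L) H (α : H → K)) (hx : (x : L) = φ (e α)) :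
    (theta e β α x : L) = φ (e β) := by
  have h : ∃ p : (L ≃ₗ[K] L) × K, p.1 ∈ adN e ∧ p.2 ≠ 0 ∧ p.1 (e α : L) = p.2 • (e β : L) ∧
      ∀ x ∈ component H (α : H → K), (p.1 : L →ₗ[K] L) x ∈ component H (β : H → K) :=
    he.exists_isTransfer hS hL hα hβ
  obtain ⟨hu, hc, huc, -⟩ := h.choose_spec
  obtain ⟨v, hv⟩ := exists_equiv_of_mem_adN hu
  -- Testing on the inclusion determines `v (e α)`, and with it the effect of `u` on `φ (e α)` for
  -- every `φ`.
  have hve : v (e α) = h.choose.2 • e β := Subtype.ext ((hv g.incl' (e α)).symm.trans huc)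
  rw [theta, dif_pos h]
  change h.choose.2⁻¹ • (h.choose.1 (x : L)) = φ (e β)
  rw [hx, hv, hve, map_smul, smul_smul, inv_mul_cancel₀ hc, one_smul]

end Transfer

/-! ### The `Λ`-grading of the coordinate algebra. -/

section HomogeneousComponents

variable {K L : Type*} [Field K] [CharZero K] [LieRing L] [LieAlgebra K L]
  {g : LieSubalgebra K L} [FiniteDimensional K g] [LieAlgebra.IsSimple K g]
  {H : LieSubalgebra K g} [H.IsCartanSubalgebra] [IsTriangularizable K H g]
  {e : Weight K H g → g} {Λ : Type*} [AddCommGroup Λ] {ℒ : Λ → Submodule K L}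

theorem mem_coordinateComponent {α : Weight K H g} {l : Λ}
    {a : component (L := L) H (α : H → K)} :
    a ∈ coordinateComponent ℒ α l ↔ (a : L) ∈ ℒ l :=
  ⟨fun h => h.2, fun h => ⟨a.2, h⟩⟩

theorem IsRootLatticeGraded.lie_mem_of_mem (hL : IsRootLatticeGraded H ℒ) {l : Λ} (y : g) {x : L}
    (hx : x ∈ ℒ l) : ⁅(y : L), x⁆ ∈ ℒ l := by
  have := hL.lie_mem 0 l y (hL.le_zero y.2) x hx
  rwa [zero_add] at this

theorem IsRootLatticeGraded.iSupIndep_coordinateComponent (hL : IsRootLatticeGraded H ℒ)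
    (α : Weight K H g) : iSupIndep (coordinateComponent ℒ α) := by
  rw [iSupIndep_iff_finsetSum_eq_zero_imp_eq_zero]
  intro s v hv hsum l hl
  refine Subtype.ext ?_
  refine (iSupIndep_iff_finsetSum_eq_zero_imp_eq_zero _).1 hL.grading_independent s
    (fun l => (v l : L)) (fun l hl => mem_coordinateComponent.1 (hv l hl)) ?_ l hl
  rw [← Submodule.coe_sum, hsum, Submodule.coe_zero]

/-- The Cartan subalgebra has degree `0`, so the homogeneous components of a weight vector satisfy
the same eigenvalue equations. -/
theorem IsRootLatticeGraded.iSup_coordinateComponent (hL : IsRootLatticeGraded H ℒ)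
    (α : Weight K H g) : (⨆ l, coordinateComponent ℒ α l) = ⊤ := by
  rw [eq_top_iff]
  rintro a -
  have ha : (a : L) ∈ ⨆ l, ℒ l := by rw [hL.grading_iSup_eq_top]; trivial
  obtain ⟨f, hf, hsum⟩ := (Submodule.mem_iSup_iff_exists_finsupp _ _).1 ha
  rw [Finsupp.sum] at hsum
  have hcomp : ∀ l ∈ f.support, f l ∈ component (L := L) H (α : H → K) := by
    intro l hl h
    rw [← sub_eq_zero]
    refine (iSupIndep_iff_finsetSum_eq_zero_imp_eq_zero _).1 hL.grading_independent f.support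
      (fun l => ⁅((h : g) : L), f l⁆ - α h • f l) (fun l _ => ?_) ?_ l hl
    · exact Submodule.sub_mem _ (hL.lie_mem_of_mem _ (hf l)) (Submodule.smul_mem _ _ (hf l))
    · rw [Finset.sum_sub_distrib, ← Finset.smul_sum, ← lie_sum, hsum, a.2 h, sub_self]
  have haf : a = ∑ l ∈ f.support.attach, ⟨f l, hcomp l l.2⟩ := by
    refine Subtype.ext ?_
    rw [Submodule.coe_sum, ← hsum]
    exact (Finset.sum_attach f.support f).symm
  rw [haf]
  exact Submodule.sum_mem _ fun l _ =>
    Submodule.mem_iSup_of_mem (l : Λ) (mem_coordinateComponent.2 (hf l))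

/-- Since `g` has degree `0`, the preimage of `ℒ l` under `φ` is an ideal of the simple algebra `g`;
it contains a nonzero vector, so it is everything. -/
theorem IsRootLatticeGraded.hom_mem (hL : IsRootLatticeGraded H ℒ) (he : IsRootVectorFamily e)
    {α : Weight K H g} (hα : α.IsNonZero) (φ : g →ₗ⁅K,g⁆ L) {l : Λ} (h : φ (e α) ∈ ℒ l) (y : g) :
    φ y ∈ ℒ l := by
  let I : LieIdeal K g :=
    { (ℒ l).comap (φ : g →ₗ[K] L) with
      lie_mem := by
        intro z y hy
        change φ ⁅z, y⁆ ∈ ℒ l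
        rw [LieModuleHom.map_lie]
        exact hL.lie_mem_of_mem z hy }
  have hI : I = ⊤ := lieIdeal_eq_top_of_mem (x := e α) h (he.ne_zero hα)
  have hy : y ∈ I := hI ▸ LieSubmodule.mem_top y
  exact hy

end HomogeneousComponents

/-! ### The Chevalley involution acting on homomorphisms. -/

section ChevalleyInvolution

variable {K L : Type*} [Field K] [CharZero K] [LieRing L] [LieAlgebra K L]
  {g : LieSubalgebra K L} [FiniteDimensional K g] [LieAlgebra.IsSimple K g]
  {H : LieSubalgebra K g} [H.IsCartanSubalgebra] [IsTriangularizable K H g]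
  {e : Weight K H g → g} {Λ : Type*} [AddCommGroup Λ] {ℒ : Λ → Submodule K L} {τ : L ≃ₗ⁅K⁆ L}

theorem IsChevalleyInvolution.apply_mem (hτ : IsChevalleyInvolution H ℒ τ) (y : g) :
    τ (y : L) ∈ g := by
  have : τ (y : L) ∈ g.map (τ : L →ₗ⁅K⁆ L) := ⟨y, y.2, rfl⟩
  rwa [hτ.map_subalgebra] at this

/-- The restriction of a Chevalley involution to the grading subalgebra. -/
def IsChevalleyInvolution.restrict (hτ : IsChevalleyInvolution H ℒ τ) : g →ₗ[K] g :=
  ((τ : L →ₗ[K] L) ∘ₗ g.toSubmodule.subtype).codRestrict g.toSubmodule hτ.apply_mem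

theorem IsChevalleyInvolution.coe_restrict (hτ : IsChevalleyInvolution H ℒ τ) (y : g) :
    (hτ.restrict y : L) = τ y := rfl

theorem IsChevalleyInvolution.restrict_restrict (hτ : IsChevalleyInvolution H ℒ τ) (y : g) :
    hτ.restrict (hτ.restrict y) = y :=
  Subtype.ext (hτ.apply_apply _)

theorem IsChevalleyInvolution.apply_cartan (hτ : IsChevalleyInvolution H ℒ τ)
    (hL : IsRootLatticeGraded H ℒ) (h : H) : τ ((h : g) : L) = -((h : g) : L) := by
  refine hτ.apply_eq_neg _ ⟨fun h' => ?_, hL.le_zero (h : g).2⟩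
  have h1 : ⁅h', h⁆ = 0 := trivial_lie_zero H H h' h
  rw [Pi.zero_apply, zero_smul]
  exact congrArg (fun z : H => ((z : g) : L)) h1

theorem IsChevalleyInvolution.restrict_mem_weightSubspace (hτ : IsChevalleyInvolution H ℒ τ)
    (hL : IsRootLatticeGraded H ℒ) {χ ψ : H → K} (hψ : ψ = -χ) {y : g}
    (hy : y ∈ weightSubspace H g χ) : hτ.restrict y ∈ weightSubspace H g ψ := by
  rw [mem_weightSubspace] at hy ⊢
  intro h
  refine Subtype.ext ?_
  have h1 : ⁅((h : g) : L), (y : L)⁆ = χ h • (y : L) := congrArg Subtype.val (hy h)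
  have h2 := congrArg τ h1
  rw [LieEquiv.map_lie, hτ.apply_cartan hL, map_smul, neg_lie, neg_eq_iff_eq_neg] at h2
  rw [hψ, Pi.neg_apply, neg_smul]
  exact h2

/-- Conjugation of homomorphisms from the adjoint module by a Chevalley involution. -/
def IsChevalleyInvolution.conj (hτ : IsChevalleyInvolution H ℒ τ) :
    (g →ₗ⁅K,g⁆ L) →ₗ[K] (g →ₗ⁅K,g⁆ L) where
  toFun φ :=
    { (τ : L →ₗ[K] L) ∘ₗ (φ : g →ₗ[K] L) ∘ₗ hτ.restrict with
      map_lie' := by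
        intro z y
        change τ (φ (hτ.restrict ⁅z, y⁆)) = ⁅(z : L), τ (φ (hτ.restrict y))⁆
        have h : hτ.restrict ⁅z, y⁆ = ⁅hτ.restrict z, hτ.restrict y⁆ :=
          Subtype.ext (LieEquiv.map_lie τ (z : L) (y : L))
        rw [h, LieModuleHom.map_lie, coe_lie_eq, LieEquiv.map_lie, hτ.coe_restrict,
          hτ.apply_apply] }
  map_add' φ ψ := by
    ext y
    exact map_add τ _ _
  map_smul' c φ := by
    ext y
    exact map_smul τ _ _

theorem IsChevalleyInvolution.conj_apply (hτ : IsChevalleyInvolution H ℒ τ) (φ : g →ₗ⁅K,g⁆ L)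
    (y : g) : hτ.conj φ y = τ (φ (hτ.restrict y)) := rfl

theorem IsChevalleyInvolution.apply_hom (hτ : IsChevalleyInvolution H ℒ τ) (φ : g →ₗ⁅K,g⁆ L)
    (y : g) : τ (φ y) = hτ.conj φ (hτ.restrict y) := by
  rw [hτ.conj_apply, hτ.restrict_restrict]

theorem IsChevalleyInvolution.conj_conj (hτ : IsChevalleyInvolution H ℒ τ) (φ : g →ₗ⁅K,g⁆ L) :
    hτ.conj (hτ.conj φ) = φ := by
  ext y
  rw [hτ.conj_apply, hτ.conj_apply, hτ.restrict_restrict, hτ.apply_apply]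

theorem IsChevalleyInvolution.conj_incl (hτ : IsChevalleyInvolution H ℒ τ) :
    hτ.conj g.incl' = g.incl' := by
  ext y
  exact hτ.apply_apply y

theorem IsChevalleyInvolution.apply_mem_component (hτ : IsChevalleyInvolution H ℒ τ) {l : Λ}
    {x : L} (hx : x ∈ ℒ l) : τ x ∈ ℒ (-l) := by
  rw [← hτ.map_grading l]
  exact ⟨x, hx, rfl⟩

end ChevalleyInvolution

/-! ### The coordinate product, and its reversal by the involution. -/

section CoordinateAlgebra

variable {K L : Type*} [Field K] [CharZero K] [LieRing L] [LieAlgebra K L]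
  {g : LieSubalgebra K L} [FiniteDimensional K g] [LieAlgebra.IsSimple K g]
  {H : LieSubalgebra K g} [H.IsCartanSubalgebra] [IsTriangularizable K H g]
  {e : Weight K H g → g} {α β γ δ : Weight K H g}

theorem IsA2Pair.left_isNonZero (h : IsA2Pair β γ) : β.IsNonZero := mem_root_iff.1 h.left_mem

theorem IsA2Pair.right_isNonZero (h : IsA2Pair β γ) : γ.IsNonZero := mem_root_iff.1 h.right_mem

theorem IsA2Pair.add_isNonZero (h : IsA2Pair β γ) (hδ : (δ : H → K) = β + γ) : δ.IsNonZero := by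
  intro h0
  rw [h0.eq] at hδ
  have h1 := (LinearIndependent.pair_iff.1 h.linearIndependent) 1 1 (by simp [← hδ])
  exact one_ne_zero h1.1

/-- The values of `β` and `γ` on the coroot of `δ` add up to `2`, and neither root equals `δ`, so
both values are `1`. By symmetry `δ` has value `1` on the coroot of `β`, which leaves `1 - 2` for
`γ`. -/
theorem HasSimplyLacedRoots.apply_coroot_add (hS : HasSimplyLacedRoots H) (hβ : β.IsNonZero)
    (hγ : γ.IsNonZero) (hδ0 : δ.IsNonZero) (hδ : (δ : H → K) = β + γ) :
    β (IsKilling.coroot δ) = 1 ∧ γ (IsKilling.coroot δ) = 1 ∧ γ (IsKilling.coroot β) = -1 := by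
  have hsum : β (IsKilling.coroot δ) + γ (IsKilling.coroot δ) = 2 := by
    rw [← IsKilling.root_apply_coroot hδ0]
    exact (congrFun hδ _).symm
  have hβδ : β ≠ δ := by
    rintro rfl
    exact hγ (by simpa using hδ)
  have hγδ : γ ≠ δ := by
    rintro rfl
    exact hβ (by simpa using hδ)
  have hβ1 : β (IsKilling.coroot δ) = 1 := by
    have h2 := hS.apply_coroot γ hδ0
    rcases hS.apply_coroot β hδ0 with h | h | h | ⟨h, -⟩ | ⟨-, h⟩
    · rw [h] at hsum
      rcases h2 with h' | h' | h' | ⟨h', -⟩ | ⟨-, h'⟩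
      on_goal 4 => exact absurd h' hγδ
      all_goals rw [h'] at hsum; norm_num at hsum
    · exact h
    · rw [h] at hsum
      rcases h2 with h' | h' | h' | ⟨h', -⟩ | ⟨-, h'⟩
      on_goal 4 => exact absurd h' hγδ
      all_goals rw [h'] at hsum; norm_num at hsum
    · exact absurd h hβδ
    · rw [h] at hsum
      rcases h2 with h' | h' | h' | ⟨h', -⟩ | ⟨-, h'⟩
      on_goal 4 => exact absurd h' hγδ
      all_goals rw [h'] at hsum; norm_num at hsum
  refine ⟨hβ1, by linear_combination hsum - hβ1, ?_⟩
  have hβδ' : β ≠ -δ := by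
    rintro rfl
    rw [Weight.coe_neg, Pi.neg_apply, IsKilling.root_apply_coroot hδ0] at hβ1
    norm_num at hβ1
  have h1 := hS.apply_coroot_symm hβ hδ0 hβ1 (Or.inl rfl) hβδ hβδ'
  have h2 : δ (IsKilling.coroot β) = β (IsKilling.coroot β) + γ (IsKilling.coroot β) :=
    congrFun hδ _
  rw [IsKilling.root_apply_coroot hβ, h1] at h2
  linear_combination -h2

theorem weight_apply_neg (μ : Weight K H g) (h : H) : μ (-h) = -μ h := map_neg μ.toLinear h

/-- `e (-β)` kills `e γ`, so applying it to `⁅e β, e γ⁆` gives back `e γ`. -/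
theorem IsRootVectorFamily.lie_ne_zero (hS : HasSimplyLacedRoots H) (he : IsRootVectorFamily e)
    (hβ : β.IsNonZero) (hγ : γ.IsNonZero) (hc : γ (IsKilling.coroot β) = -1) :
    ⁅e β, e γ⁆ ≠ 0 := by
  intro h
  have hβ' : (-β).IsNonZero := by simpa using hβ
  have hval : γ (IsKilling.coroot (-β)) = 1 := by
    rw [IsKilling.coroot_neg, weight_apply_neg, hc, neg_neg]
  have h0 : ⁅e (-β), e γ⁆ = 0 := (isWeightGraded_adjoint H).lie_eq_zero hS hβ' (fun h => hγ h)
    (n := 1) (by rw [hval]; norm_num) (he.mem _ hβ') (he.mem γ hγ)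
  have h1 := he.lie_lie_of_lie_eq_zero hβ' (he.mem γ hγ) h0
  rw [neg_neg, h, lie_zero, hval, one_smul] at h1
  exact he.ne_zero hγ h1.symm

theorem IsRootVectorFamily.structureConstant_spec (he : IsRootVectorFamily e)
    (hβ : β.IsNonZero) (hγ : γ.IsNonZero) (hδ0 : δ.IsNonZero) (hδ : (δ : H → K) = β + γ) :
    ⁅e β, e γ⁆ = structureConstant e β γ δ • e δ := by
  have h : ∃ c : K, ⁅e β, e γ⁆ = c • e δ :=
    he.exists_eq_smul hδ0 (lie_mem_weightSubspace hδ (he.mem β hβ) (he.mem γ hγ))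
  rw [structureConstant, dif_pos h]
  exact h.choose_spec

theorem IsRootVectorFamily.structureConstant_ne_zero (hS : HasSimplyLacedRoots H)
    (he : IsRootVectorFamily e) (hβ : β.IsNonZero) (hγ : γ.IsNonZero) (hδ0 : δ.IsNonZero)
    (hδ : (δ : H → K) = β + γ) : structureConstant e β γ δ ≠ 0 := by
  intro h
  have h1 := he.structureConstant_spec hβ hγ hδ0 hδ
  rw [h, zero_smul] at h1
  exact he.lie_ne_zero hS hβ hγ (hS.apply_coroot_add hβ hγ hδ0 hδ).2.2 h1

/-- Homomorphisms from the adjoint module correspond to the elements of the coordinate algebra, by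
evaluation at the root vector. -/
noncomputable def IsRootVectorFamily.homEquiv (hS : HasSimplyLacedRoots H)
    (he : IsRootVectorFamily e) (hL : IsWeightGraded H L) (hα : α.IsNonZero) :
    (g →ₗ⁅K,g⁆ L) ≃ₗ[K] component (L := L) H (α : H → K) :=
  LinearEquiv.ofBijective
    { toFun := fun φ => ⟨φ (e α), mem_component_iff_mem_weightSubspace.2
        (map_mem_weightSubspace φ (he.mem α hα))⟩
      map_add' := fun _ _ => rfl
      map_smul' := fun _ _ => rfl }
    ⟨fun _ _ h => he.hom_ext hα (congrArg Subtype.val h), fun x => by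
      obtain ⟨φ, hφ⟩ := he.exists_hom hS hL hα (mem_component_iff_mem_weightSubspace.1 x.2)
      exact ⟨φ, Subtype.ext hφ⟩⟩

/-- The multiplication of the coordinate algebra in terms of homomorphisms from the adjoint
module. -/
theorem IsRootVectorFamily.coordinateMul_homEquiv (hS : HasSimplyLacedRoots H)
    (he : IsRootVectorFamily e) (hL : IsWeightGraded H L) (hα : α.IsNonZero) (hβ : β.IsNonZero)
    (hγ : γ.IsNonZero) (hδ0 : δ.IsNonZero) (hδ : (δ : H → K) = β + γ) {φ ψ χ : g →ₗ⁅K,g⁆ L}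
    (h : ⁅φ (e β), ψ (e γ)⁆ = structureConstant e β γ δ • χ (e δ)) :
    coordinateMul e α β γ δ hδ (he.homEquiv hS hL hα φ) (he.homEquiv hS hL hα ψ) =
      he.homEquiv hS hL hα χ := by
  have hN := he.structureConstant_ne_zero hS hβ hγ hδ0 hδ
  refine Subtype.ext ?_
  have hφ := he.theta_apply hS hL hα hβ φ (he.homEquiv hS hL hα φ) rfl
  have hψ := he.theta_apply hS hL hα hγ ψ (he.homEquiv hS hL hα ψ) rfl
  have hχ := he.theta_apply hS hL hδ0 hα (structureConstant e β γ δ • χ)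
    ⟨⁅(theta e β α (he.homEquiv hS hL hα φ) : L), (theta e γ α (he.homEquiv hS hL hα ψ) : L)⁆,
        lie_mem_component H hδ (theta e β α _).2 (theta e γ α _).2⟩ (by
      simp only [hφ, hψ, h]
      rfl)
  change (structureConstant e β γ δ)⁻¹ • (theta e α δ _ : L) = χ (e α)
  rw [hχ, LieModuleHom.smul_apply, smul_smul, inv_mul_cancel₀ hN, one_smul]

/-- This defines the product on `Hom_g(g, L)`: the bracket has weight `δ`, and each vector of that
weight is the value of a homomorphism at `e δ`. -/
theorem IsRootVectorFamily.exists_hom_mul (hS : HasSimplyLacedRoots H)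
    (he : IsRootVectorFamily e) (hL : IsWeightGraded H L) (hβ : β.IsNonZero)
    (hγ : γ.IsNonZero) (hδ0 : δ.IsNonZero) (hδ : (δ : H → K) = β + γ) (φ ψ : g →ₗ⁅K,g⁆ L) :
    ∃ χ : g →ₗ⁅K,g⁆ L, ⁅φ (e β), ψ (e γ)⁆ = structureConstant e β γ δ • χ (e δ) := by
  have hN := he.structureConstant_ne_zero hS hβ hγ hδ0 hδ
  have hmem : ⁅φ (e β), ψ (e γ)⁆ ∈ weightSubspace H L (δ : H → K) := by
    have h1 := map_mem_weightSubspace φ (he.mem β hβ)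
    have h2 := map_mem_weightSubspace ψ (he.mem γ hγ)
    rw [← mem_component_iff_mem_weightSubspace] at h1 h2 ⊢
    exact lie_mem_component H hδ h1 h2
  obtain ⟨χ, hχ⟩ := he.exists_hom hS hL hδ0
    (Submodule.smul_mem _ (structureConstant e β γ δ)⁻¹ hmem)
  exact ⟨χ, by rw [hχ, smul_smul, mul_inv_cancel₀ hN, one_smul]⟩

variable {Λ : Type*} [AddCommGroup Λ] {ℒ : Λ → Submodule K L} {τ : L ≃ₗ⁅K⁆ L}

/-- Conjugation by a Chevalley involution reverses products. -/
theorem IsRootVectorFamily.lie_conj (hS : HasSimplyLacedRoots H) (he : IsRootVectorFamily e)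
    (hL : IsRootLatticeGraded H ℒ) (hτ : IsChevalleyInvolution H ℒ τ) (hβ : β.IsNonZero)
    (hγ : γ.IsNonZero) (hδ0 : δ.IsNonZero) (hδ : (δ : H → K) = β + γ) {φ ψ χ : g →ₗ⁅K,g⁆ L}
    (h : ⁅φ (e β), ψ (e γ)⁆ = structureConstant e β γ δ • χ (e δ)) :
    ⁅hτ.conj ψ (e β), hτ.conj φ (e γ)⁆ = structureConstant e β γ δ • hτ.conj χ (e δ) := by
  set N := structureConstant e β γ δ with hNdef
  have hN : N ≠ 0 := he.structureConstant_ne_zero hS hβ hγ hδ0 hδ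
  obtain ⟨hβδ, hγδ, -⟩ := hS.apply_coroot_add hβ hγ hδ0 hδ
  have hδ' : (-δ).IsNonZero := by simpa using hδ0
  have hA := isWeightGraded_adjoint (K := K) (𝔤 := g) H
  -- `ad f` lowers `β` to `-γ` and `γ` to `-β`, and its square lowers `δ` to `-δ`; this is what
  -- exchanges the two factors.
  set f := e (-δ) with hf
  have hfmem := he.mem (-δ) hδ'
  have ha : ⁅f, e β⁆ ∈ weightSubspace H g ((-γ : Weight K H g) : H → K) :=
    lie_mem_weightSubspace (by simp [hδ]) hfmem (he.mem β hβ)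
  have hb : ⁅f, e γ⁆ ∈ weightSubspace H g ((-β : Weight K H g) : H → K) :=
    lie_mem_weightSubspace (by simp [hδ]) hfmem (he.mem γ hγ)
  have hc : ⁅f, ⁅f, e δ⁆⁆ ∈ weightSubspace H g ((-δ : Weight K H g) : H → K) :=
    lie_mem_weightSubspace (ψ := 0) (by simp) hfmem
      (lie_mem_weightSubspace (by simp) hfmem (he.mem δ hδ0))
  have ha0 : ⁅f, ⁅f, e β⁆⁆ = 0 := by
    refine hA.lie_eq_zero hS hδ' (n := 1) (fun h => hγ (by simpa using h)) ?_ hfmem ha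
    rw [IsKilling.coroot_neg, weight_apply_neg, Weight.coe_neg, Pi.neg_apply, hγδ]
    norm_num
  have hb0 : ⁅f, ⁅f, e γ⁆⁆ = 0 := by
    refine hA.lie_eq_zero hS hδ' (n := 1) (fun h => hβ (by simpa using h)) ?_ hfmem hb
    rw [IsKilling.coroot_neg, weight_apply_neg, Weight.coe_neg, Pi.neg_apply, hβδ]
    norm_num
  have hc0 : ⁅f, ⁅f, e δ⁆⁆ ≠ 0 := by
    intro h0
    have h1 := he.lie_lie_lie_of_lie_eq_zero hδ0 (he.mem δ hδ0) (lie_self _)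
    have h2 := he.lie_lie_of_lie_eq_zero hδ0 (he.mem δ hδ0) (lie_self _)
    rw [← hf, h0, lie_zero, eq_comm, smul_eq_zero] at h1
    rw [← hf, h1.resolve_left two_ne_zero, lie_zero, IsKilling.root_apply_coroot hδ0, eq_comm,
      smul_eq_zero] at h2
    exact he.ne_zero hδ0 (h2.resolve_left two_ne_zero)
  obtain ⟨r, hr⟩ := he.exists_eq_smul hγ (hτ.restrict_mem_weightSubspace hL (by simp) ha)
  obtain ⟨s, hs⟩ := he.exists_eq_smul hβ (hτ.restrict_mem_weightSubspace hL (by simp) hb)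
  obtain ⟨k, hk⟩ := he.exists_eq_smul hδ0 (hτ.restrict_mem_weightSubspace hL (by simp) hc)
  have hk0 : k ≠ 0 := by
    rintro rfl
    rw [zero_smul] at hk
    apply hc0
    rw [← hτ.restrict_restrict ⁅f, ⁅f, e δ⁆⁆, hk, map_zero]
  -- Since `(ad f)²` kills `e β` and `e γ`, only the cross term `2 [φ[f, e_β], ψ[f, e_γ]]` of the
  -- Leibniz expansion survives; then `τ` is applied. The scalars `r`, `s`, `k` come from `g` alone.
  have key : ∀ φ ψ χ : g →ₗ⁅K,g⁆ L, ⁅φ (e β), ψ (e γ)⁆ = N • χ (e δ) →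
      (2 * r * s) • ⁅hτ.conj φ (e γ), hτ.conj ψ (e β)⁆ = (N * k) • hτ.conj χ (e δ) := by
    intro φ ψ χ h
    have hlie : ∀ (φ : g →ₗ⁅K,g⁆ L) (y : g), ⁅(f : L), φ y⁆ = φ ⁅f, y⁆ := fun φ y =>
      (φ.map_lie f y).symm
    have h1 := congrArg (fun x => ⁅(f : L), ⁅(f : L), x⁆⁆) h
    simp only [leibniz_lie (f : L) (φ _) (ψ _), lie_add, lie_smul, hlie, ha0, hb0, map_zero,
      zero_lie, lie_zero, zero_add, add_zero] at h1
    rw [← two_smul K] at h1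
    have h2 := congrArg τ h1
    rw [map_smul, map_smul, LieEquiv.map_lie, hτ.apply_hom, hτ.apply_hom, hτ.apply_hom, hr, hs, hk,
      map_smul, map_smul, map_smul, smul_lie, lie_smul, smul_smul, smul_smul, smul_smul] at h2
    rw [← h2]
  have hincl := he.structureConstant_spec hβ hγ hδ0 hδ
  -- The case of the inclusion yields `2rs = -k`; the minus sign cancels against the skew-symmetry
  -- of the bracket when the factors are put back in order.
  have h1 := key g.incl' g.incl' g.incl' (congrArg Subtype.val hincl)
  rw [hτ.conj_incl] at h1
  have h2 : (2 * r * s) • ⁅e γ, e β⁆ = (N * k) • e δ := Subtype.ext h1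
  rw [← lie_skew, hincl, ← neg_smul, smul_smul] at h2
  have h3 : 2 * r * s = -k := by
    have h4 := smul_left_injective K (he.ne_zero hδ0) h2
    have h5 : N * (2 * r * s) = N * (-k) := by linear_combination -h4
    exact mul_left_cancel₀ hN h5
  have h4 := key φ ψ χ h
  rw [h3, ← lie_skew, smul_neg, neg_smul, neg_neg, mul_comm, mul_smul] at h4
  exact smul_right_injective L hk0 h4

theorem IsRootVectorFamily.isGradedAlgebra (hS : HasSimplyLacedRoots H)
    (he : IsRootVectorFamily e) (hL : IsRootLatticeGraded H ℒ) (hα : α.IsNonZero)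
    (hβ : β.IsNonZero) (hγ : γ.IsNonZero) (hδ0 : δ.IsNonZero) (hδ : (δ : H → K) = β + γ) :
    IsGradedAlgebra (coordinateMul e α β γ δ hδ) (coordinateComponent ℒ α) where
  independent := hL.iSupIndep_coordinateComponent α
  iSup_eq_top := hL.iSup_coordinateComponent α
  mul_mem l k a ha b hb := by
    have hW := hL.toIsRootGraded.isWeightGraded
    obtain ⟨φ, rfl⟩ := (he.homEquiv hS hW hα).surjective a
    obtain ⟨ψ, rfl⟩ := (he.homEquiv hS hW hα).surjective b
    obtain ⟨χ, hχ⟩ := he.exists_hom_mul hS hW hβ hγ hδ0 hδ φ ψ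
    rw [he.coordinateMul_homEquiv hS hW hα hβ hγ hδ0 hδ hχ, mem_coordinateComponent]
    refine hL.hom_mem he hδ0 χ ?_ (e α)
    have h1 := hL.lie_mem l k _ (hL.hom_mem he hα φ (mem_coordinateComponent.1 ha) (e β)) _
      (hL.hom_mem he hα ψ (mem_coordinateComponent.1 hb) (e γ))
    rw [hχ] at h1
    exact (Submodule.smul_mem_iff _ (he.structureConstant_ne_zero hS hβ hγ hδ0 hδ)).1 h1

theorem IsRootVectorFamily.exists_isPreChevalley (hS : HasSimplyLacedRoots H)
    (he : IsRootVectorFamily e) (hL : IsRootLatticeGraded H ℒ)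
    (hτ : IsChevalleyInvolution H ℒ τ) (hα : α.IsNonZero)
    (hβ : β.IsNonZero) (hγ : γ.IsNonZero) (hδ0 : δ.IsNonZero) (hδ : (δ : H → K) = β + γ) :
    ∃ bar : component (L := L) H (α : H → K) →ₗ[K] component (L := L) H (α : H → K),
      IsPreChevalley (coordinateMul e α β γ δ hδ) (coordinateComponent ℒ α) bar := by
  have hW := hL.toIsRootGraded.isWeightGraded
  let E := he.homEquiv hS hW hα
  let bar : component (L := L) H (α : H → K) →ₗ[K] component (L := L) H (α : H → K) :=
    E.toLinearMap ∘ₗ hτ.conj ∘ₗ E.symm.toLinearMap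
  have hbar : ∀ φ, bar (E φ) = E (hτ.conj φ) := fun φ => by simp [bar]
  have hbb : ∀ a, bar (bar a) = a := by
    intro a
    obtain ⟨φ, rfl⟩ := E.surjective a
    rw [hbar, hbar, hτ.conj_conj]
  have hmap : ∀ (l : Λ), ∀ a ∈ coordinateComponent ℒ α l, bar a ∈ coordinateComponent ℒ α (-l) := by
    intro l a ha
    obtain ⟨φ, rfl⟩ := E.surjective a
    rw [hbar, mem_coordinateComponent]
    exact hτ.apply_mem_component (hL.hom_mem he hα φ (mem_coordinateComponent.1 ha) _)
  refine ⟨bar, ⟨⟨fun a b => ?_, hbb⟩, fun l => le_antisymm ?_ fun b hb => ?_⟩⟩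
  · obtain ⟨φ, rfl⟩ := E.surjective a
    obtain ⟨ψ, rfl⟩ := E.surjective b
    obtain ⟨χ, hχ⟩ := he.exists_hom_mul hS hW hβ hγ hδ0 hδ φ ψ
    rw [he.coordinateMul_homEquiv hS hW hα hβ hγ hδ0 hδ hχ]
    change bar (E χ) = _
    rw [hbar, hbar, hbar]
    exact (he.coordinateMul_homEquiv hS hW hα hβ hγ hδ0 hδ
      (he.lie_conj hS hL hτ hβ hγ hδ0 hδ hχ)).symm
  · rintro _ ⟨a, ha, rfl⟩
    exact hmap l a ha
  · have h1 := hmap _ b hb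
    rw [neg_neg] at h1
    exact ⟨bar b, h1, hbb b⟩

end CoordinateAlgebra

end RootGraded

theorem proposition3p9 {K L Λ : Type*} [Field K] [CharZero K] [LieRing L] [LieAlgebra K L]
    [AddCommGroup Λ] [Module.Free ℤ Λ]
    (g : LieSubalgebra K L) [FiniteDimensional K g] [LieAlgebra.IsSimple K g]
    (H : LieSubalgebra K g) [H.IsCartanSubalgebra] [LieModule.IsTriangularizable K H g]
    (ℒ : Λ → Submodule K L) (hL : RootGraded.IsDivisionGraded H ℒ)
    (hlaced : RootGraded.IsSimplyLaced H) (hrank : 2 ≤ Module.finrank K H)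
    (τ : L ≃ₗ⁅K⁆ L) (hτ : RootGraded.IsChevalleyInvolution H ℒ τ)
    (e : LieModule.Weight K H g → g) (he : RootGraded.IsChevalleyBasis e)
    (α : LieModule.Weight K H g) (hα : α ∈ H.root)
    (β γ δ : LieModule.Weight K H g) (hpair : RootGraded.IsA2Pair β γ)
    (hδ : (δ : H → K) = β + γ) :
    RootGraded.IsGradedAlgebra (RootGraded.coordinateMul e α β γ δ hδ)
        (RootGraded.coordinateComponent ℒ α) ∧
      ∃ bar : RootGraded.component H (α : H → K) →ₗ[K] RootGraded.component H (α : H → K),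
        RootGraded.IsPreChevalley (RootGraded.coordinateMul e α β γ δ hδ)
          (RootGraded.coordinateComponent ℒ α) bar := by
  have hS := hlaced.hasSimplyLacedRoots
  have he' := he.isRootVectorFamily
  have hL' := hL.toIsRootLatticeGraded
  have hα' := RootGraded.mem_root_iff.1 hα
  have hδ0 := hpair.add_isNonZero hδ
  exact ⟨he'.isGradedAlgebra hS hL' hα' hpair.left_isNonZero hpair.right_isNonZero hδ0 hδ,
    he'.exists_isPreChevalley hS hL' hτ hα' hpair.left_isNonZero hpair.right_isNonZero hδ0 hδ⟩
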